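/- Let $\mathbf k$ be a field of characteristic zero and let $V$ be a $\mathbf k$-vector space (of any dimension). For $n\ge 0$ put $$C^n_{\mathrm{postLie}}(V,V)=\bigoplus_{i=0}^{n}\mathrm{Hom}(\wedge^iV\otimes\wedge^{n+1-i}V,V),\qquad C^*_{\mathrm{postLie}}(V,V)=\bigoplus_{n\ge 0}C^n_{\mathrm{postLie}}(V,V),$$ and write $f=(f_0,\dots,f_n)\in C^n_{\mathrm{postLie}}(V,V)$ with $f_i\in \mathrm{Hom}(\wedge^iV\otimes\wedge^{n+1-i}V,V)$. Let $\mathbb S_{(i_1,\dots,i_r)}$ denote the set of $(i_1,\dots,i_r)$-shuffles, i.e. the permutations of $\{1,\dots,i_1+\cdots+i_r\}$ that are increasing on each of the $r$ consecutive blocks of lengths $i_1,\dots,i_r$, and let $(-1)^\sigma$ be the sign of $\sigma$. For $f\in C^n_{\mathrm{postLie}}(V,V)$ and $g\in C^m_{\mathrm{postLie}}(V,V)$ define $f\circ g\in C^{n+m}_{\mathrm{postLie}}(V,V)$ by $$(f\circ g)_k(x_1\cdots x_k\otimes x_{k+1}\cdots x_{n+m+1})=A_k+B_k,\qquad 0\le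 k\le n+m,$$ where $$B_k=\sum_{j}\ \sum_{\sigma\in\mathbb S_{(k-j,j)}}\ \sum_{\tau\in\mathbb S_{(m+1-j,n+j-k)}}(-1)^\sigma(-1)^\tau(-1)^{m(k-j)} f_{k-j}\big(x_{\sigma(1)}\cdots x_{\sigma(k-j)}\otimes g_j(x_{\sigma(k-j+1)}\cdots x_{\sigma(k)}\otimes x_{k+\tau(1)}\cdots x_{k+\tau(m+1-j)})\,x_{k+\tau(m+2-j)}\cdots x_{k+\tau(n+m+1-k)}\big),$$ the outer sum being over all integers $j$ with $0\le j\le \min(k,m)$ and $k-j\le n$; where $A_k=0$ for $k\le m$; and where for $m+1\le k\le n+m$ $$A_k=\sum_{j=0}^{m}\ \sum_{\sigma\in\mathbb S_{(j,m+1-j,k-m-1)}}(-1)^\sigma f_{k-m}\big(g_j(x_{\sigma(1)}\cdots x_{\sigma(j)}\otimes x_{\sigma(j+1)}\cdots x_{\sigma(m+1)})\,x_{\sigma(m+2)}\cdots x_{\sigma(k)}\otimes x_{k+1}\cdots x_{n+m+1}\big).$$ A post-Lie algebra structure on $V$ is a pair consisting of a Lie bracket $[\cdot,\cdot]$ on $V$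 and a bilinear product $\rhd$ on $V$ such that, for all $x,y,z\in V$, $$x\rhd[y,z]=[x\rhd y,z]+[y,x\rhd z],\qquad ([x,y]+x\rhd y-y\rhd x)\rhd z=x\rhd(y\rhd z)-y\rhd(x\rhd z).$$ A Maurer–Cartan element of a graded Lie algebra is an element $\pi$ of degree $1$ with $[\pi,\pi]=0$. **Theorem.** With the bilinear bracket determined by $$[f,g]_{\mathrm{postLie}}=f\circ g-(-1)^{nm}\,g\circ f,\qquad f\in C^n_{\mathrm{postLie}}(V,V),\ g\in C^m_{\mathrm{postLie}}(V,V),$$ $C^*_{\mathrm{postLie}}(V,V)$ is a graded Lie algebra: the bracket has degree $0$, and for $f,g,h$ homogeneous of degrees $n,m,l$ one has $[f,g]=-(-1)^{nm}[g,f]$ and $[f,[g,h]]=[[f,g],h]+(-1)^{nm}[g,[f,h]]$. Moreover, its Maurer–Cartan elements $\pi=(\pi_0,\pi_1)\in C^1_{\mathrm{postLie}}(V,V)$ are precisely the post-Lie algebra structures on $V$: the assignment $[x,y]=\pi_0(xy)$, $x\rhd y=\pi_1(x\otimes y)$ is a bijection from the set of Maurer–Cartan elements onto the set of post-Lie algebra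 structures on $V$. -/

import Mathlib

open scoped TensorProduct DirectSum

namespace PostLie

/-! ### Shuffles -/

/-- A permutation `σ` of `{0, …, k-1}` is a shuffle for a partition of the positions into blocks
(`c a` is the label of the block of the position `a`) if `σ` is increasing on every block. -/
def IsShuffle {k : ℕ} (c : Fin k → ℕ) (σ : Equiv.Perm (Fin k)) : Prop :=
  ∀ a b, a < b → c a = c b → σ a < σ b

/-- Two consecutive blocks of positions, the first one of length `p`. -/
def block₂ (p : ℕ) {k : ℕ} (a : Fin k) : ℕ := if (a : ℕ) < p then 0 else 1

/-- Three consecutive blocks of positions, the first two of lengths `p` and `q`. -/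
def block₃ (p q : ℕ) {k : ℕ} (a : Fin k) : ℕ :=
  if (a : ℕ) < p then 0 else if (a : ℕ) < p + q then 1 else 2

open Classical in
/-- The finite set `𝕊_{(p, k-p)}` of `(p, k-p)`-shuffles. -/
noncomputable def shuffles₂ (p k : ℕ) : Finset (Equiv.Perm (Fin k)) :=
  Finset.univ.filter (IsShuffle (block₂ p))

open Classical in
/-- The finite set `𝕊_{(p, q, k-p-q)}` of `(p, q, k-p-q)`-shuffles. -/
noncomputable def shuffles₃ (p q k : ℕ) : Finset (Equiv.Perm (Fin k)) :=
  Finset.univ.filter (IsShuffle (block₃ p q))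

section Alternation

variable {K V N : Type*} [CommRing K] [AddCommGroup V] [Module K V] [AddCommGroup N] [Module K N]

theorem swap_of_adjacent {n : ℕ} (G : MultilinearMap K (fun _ : Fin (n + 1) => V) N)
    (hG : ∀ v (i : Fin n), v i.castSucc = v i.succ → G v = 0)
    (v : Fin (n + 1) → V) (i : Fin n) :
    G (fun a => v (Equiv.swap i.castSucc i.succ a)) = - G v := by
  have hne : i.castSucc ≠ i.succ := (Fin.castSucc_lt_succ).ne
  set x := v i.castSucc with hx
  set y := v i.succ with hy
  have addR : ∀ a b b' : V, G (Function.update (Function.update v i.castSucc a) i.succ (b + b')) =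
      G (Function.update (Function.update v i.castSucc a) i.succ b) +
        G (Function.update (Function.update v i.castSucc a) i.succ b') :=
    fun a b b' => G.map_update_add _ _ _ _
  have addL : ∀ a a' b : V, G (Function.update (Function.update v i.castSucc (a + a')) i.succ b) =
      G (Function.update (Function.update v i.castSucc a) i.succ b) +
        G (Function.update (Function.update v i.castSucc a') i.succ b) := by
    intro a a' b
    simp only [Function.update_comm hne _ b v]
    exact G.map_update_add _ _ _ _
  have z : ∀ a : V, G (Function.update (Function.update v i.castSucc a) i.succ a) = 0 := by
    intro a
    apply hG _ i
    rw [Function.update_of_ne hne, Function.update_self, Function.update_self]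
  have e1 : Function.update (Function.update v i.castSucc x) i.succ y = v := by
    rw [hx, hy]; simp
  have e2 : Function.update (Function.update v i.castSucc y) i.succ x =
      fun a => v (Equiv.swap i.castSucc i.succ a) := by
    funext a
    by_cases h1 : a = i.succ
    · subst h1; simp [hx]
    · by_cases h2 : a = i.castSucc
      · subst h2; rw [Function.update_of_ne hne, Function.update_self]; simp [hy]
      · rw [Function.update_of_ne h1, Function.update_of_ne h2, Equiv.swap_apply_of_ne_of_ne h2 h1]
  have h := z (x + y)
  rw [addR, addL, addL, z, z, e1, e2] at h
  rw [eq_neg_iff_add_eq_zero]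
  simpa using h

theorem eq_zero_of_adjacent {n : ℕ} (G : MultilinearMap K (fun _ : Fin (n + 1) => V) N)
    (hG : ∀ v (i : Fin n), v i.castSucc = v i.succ → G v = 0)
    (v : Fin (n + 1) → V) (i j : Fin (n + 1)) (hv : v i = v j) (hij : i ≠ j) : G v = 0 := by
  have perm : ∀ σ : Equiv.Perm (Fin (n + 1)), ∀ w : Fin (n + 1) → V,
      G (fun a => w (σ a)) = 0 → G w = 0 := by
    intro σ
    have hσ : σ ∈ Submonoid.closure
        (Set.range fun i : Fin n ↦ Equiv.swap i.castSucc i.succ) := by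
      rw [Equiv.Perm.mclosure_swap_castSucc_succ]; trivial
    induction hσ using Submonoid.closure_induction with
    | mem s hs =>
      obtain ⟨t, rfl⟩ := hs
      intro w hw
      have := swap_of_adjacent G hG w t
      rw [this] at hw
      simpa using hw
    | one => intro w hw; simpa using hw
    | mul s t _ _ ihs iht =>
      intro w hw
      apply ihs
      apply iht
      simpa using hw
  obtain _ | n := n
  · exact absurd (Fin.ext (by omega)) hij
  · have h0 : Equiv.swap 0 i j ≠ 0 := by
      intro h
      have := congrArg (Equiv.swap 0 i) h
      simp at this
      exact hij this.symm
    refine perm (Equiv.swap 0 i * Equiv.swap 1 (Equiv.swap 0 i j)) v (hG _ 0 ?_)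
    have h01 : (0 : Fin (n + 2)) ≠ 1 := by simp
    simp [Equiv.swap_apply_of_ne_of_ne h01 h0.symm, hv]

/-- The signed sum over shuffles of a multilinear map that is alternating on every block is
alternating. -/
theorem shuffle_sum_eq_zero {k : ℕ} (c : Fin k → ℕ) (S : Finset (Equiv.Perm (Fin k)))
    (hS : ∀ σ, σ ∈ S ↔ IsShuffle c σ) (G : MultilinearMap K (fun _ : Fin k => V) N)
    (hG : ∀ v i j, v i = v j → i ≠ j → c i = c j → G v = 0)
    (v : Fin k → V) (i j : Fin k) (hv : v i = v j) (hij : i ≠ j) :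
    (∑ σ ∈ S, Equiv.Perm.sign σ • G.domDomCongr σ) v = 0 := by
  obtain _ | n := k
  · exact i.elim0
  refine eq_zero_of_adjacent _ ?_ v i j hv hij
  intro w t ht
  rw [sum_apply]
  set s := Equiv.swap t.castSucc t.succ with hs
  have hws : ∀ a, w (s a) = w a := by
    intro a
    rw [hs, Equiv.swap_apply_def]
    split_ifs with h1 h2
    · rw [h1, ht]
    · rw [h2, ht]
    · rfl
  have hterm : ∀ σ : Equiv.Perm (Fin (n + 1)),
      c (σ.symm t.castSucc) = c (σ.symm t.succ) →
      (Equiv.Perm.sign σ • G.domDomCongr σ) w = 0 := by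
    intro σ hc
    have : G (fun a => w (σ a)) = 0 := by
      refine hG _ (σ.symm t.castSucc) (σ.symm t.succ) (by simpa using ht) ?_ hc
      intro h
      exact (Fin.castSucc_lt_succ (i := t)).ne (σ.symm.injective h)
    show Equiv.Perm.sign σ • G (fun a => w (σ a)) = 0
    rw [this, smul_zero]
  have hval : ∀ a : Fin (n + 1), ((s a : Fin (n + 1)) : ℕ) =
      if (a : ℕ) = t then (t : ℕ) + 1 else if (a : ℕ) = t + 1 then (t : ℕ) else a := by
    intro a
    rw [hs, Equiv.swap_apply_def]
    simp only [Fin.ext_iff, Fin.val_castSucc, Fin.val_succ]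
    split_ifs <;> simp
  have hterm' : ∀ σ : Equiv.Perm (Fin (n + 1)),
      (Equiv.Perm.sign (s * σ) • G.domDomCongr (s * σ)) w =
        - (Equiv.Perm.sign σ • G.domDomCongr σ) w := by
    intro σ
    show Equiv.Perm.sign (s * σ) • G (fun a => w (s (σ a))) =
      - (Equiv.Perm.sign σ • G (fun a => w (σ a)))
    rw [Equiv.Perm.sign_mul, hs, Equiv.Perm.sign_swap (Fin.castSucc_lt_succ).ne, ← hs]
    simp [hws, Units.neg_smul]
  refine Finset.sum_involution (fun σ _ => if c (σ.symm t.castSucc) = c (σ.symm t.succ) then σ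
    else s * σ) ?_ ?_ ?_ ?_
  · intro σ _
    split_ifs with hc
    · rw [hterm σ hc, add_zero]
    · rw [hterm' σ, add_neg_cancel]
  · intro σ _ hne
    have hc : ¬ c (σ.symm t.castSucc) = c (σ.symm t.succ) := fun hc => hne (hterm σ hc)
    rw [if_neg hc]
    intro h
    have h1 : s = 1 := by simpa using h
    have := hval t.castSucc
    rw [h1] at this
    simp at this
  · intro σ hσ
    split_ifs with hc
    · exact hσ
    · rw [hS] at hσ ⊢
      intro a b hab hcab
      have h := hσ a b hab hcab
      have hcon : ¬ (((σ a : Fin (n + 1)) : ℕ) = t ∧ ((σ b : Fin (n + 1)) : ℕ) = t + 1) := by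
        rintro ⟨ha, hb⟩
        apply hc
        have ha' : σ a = t.castSucc := Fin.ext ha
        have hb' : σ b = t.succ := Fin.ext (by simpa using hb)
        rw [← ha', ← hb']
        simpa using hcab
      rw [Fin.lt_def] at h ⊢
      rw [Equiv.Perm.mul_apply, Equiv.Perm.mul_apply, hval, hval]
      split_ifs <;> omega
  · intro σ _
    have hss : ∀ a, s (s a) = a := by intro a; rw [hs]; simp
    have e1 : (s * σ).symm t.castSucc = σ.symm t.succ := by
      rw [Equiv.symm_apply_eq, Equiv.Perm.mul_apply, Equiv.apply_symm_apply, hs]; simp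
    have e2 : (s * σ).symm t.succ = σ.symm t.castSucc := by
      rw [Equiv.symm_apply_eq, Equiv.Perm.mul_apply, Equiv.apply_symm_apply, hs]; simp
    by_cases hc : c (σ.symm t.castSucc) = c (σ.symm t.succ)
    · simp only [if_pos hc]
    · simp only [if_neg hc]
      rw [e1, e2, if_neg (fun h => hc h.symm)]
      ext a
      simp [hss]

/-- The alternating map `v ↦ ∑_σ (-1)^σ G (v_{σ(1)}, …, v_{σ(k)})`, the sum being over the shuffles
`σ` for the blocks `c`, where `G` is multilinear and alternating on every block. -/
noncomputable def shuffleSum {k : ℕ} (c : Fin k → ℕ) (S : Finset (Equiv.Perm (Fin k)))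
    (hS : ∀ σ, σ ∈ S ↔ IsShuffle c σ) (G : MultilinearMap K (fun _ : Fin k => V) N)
    (hG : ∀ v i j, v i = v j → i ≠ j → c i = c j → G v = 0) : V [⋀^Fin k]→ₗ[K] N where
  toMultilinearMap := ∑ σ ∈ S, Equiv.Perm.sign σ • G.domDomCongr σ
  map_eq_zero_of_eq' := shuffle_sum_eq_zero c S hS G hG

theorem shuffleSum_apply {k : ℕ} (c : Fin k → ℕ) (S : Finset (Equiv.Perm (Fin k)))
    (hS : ∀ σ, σ ∈ S ↔ IsShuffle c σ) (G : MultilinearMap K (fun _ : Fin k => V) N)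
    (hG : ∀ v i j, v i = v j → i ≠ j → c i = c j → G v = 0) (v : Fin k → V) :
    shuffleSum c S hS G hG v = ∑ σ ∈ S, Equiv.Perm.sign σ • G (fun a => v (σ a)) := by
  show (∑ σ ∈ S, Equiv.Perm.sign σ • G.domDomCongr σ) v = _
  rw [sum_apply]
  rfl

end Alternation

/-! ### Shuffle sums of alternating maps -/

section ShuffleSums

variable {K V N N' : Type*} [CommRing K] [AddCommGroup V] [Module K V] [AddCommGroup N] [Module K N]
  [AddCommGroup N'] [Module K N']

/-- An alternating map in `p` arguments is an alternating map in `p'` arguments if `p = p'`. -/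
def castAlt {p p' : ℕ} (h : p = p') : (V [⋀^Fin p]→ₗ[K] N) ≃ₗ[K] (V [⋀^Fin p']→ₗ[K] N) :=
  AlternatingMap.domDomCongrₗ K (finCongr h)

/-- The multilinear map `(x₁, …, x_k) ↦ F (x₁, …, x_p) (x_{p+1}, …, x_k)`, where `k = p + q`. -/
def join₂ (p q k : ℕ) (h : p + q = k) (F : V [⋀^Fin p]→ₗ[K] (V [⋀^Fin q]→ₗ[K] N)) :
    MultilinearMap K (fun _ : Fin k => V) N :=
  (((AlternatingMap.toMultilinearMapLM (S := K)).compMultilinearMap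
    F.toMultilinearMap).uncurrySum).domDomCongr (finSumFinEquiv.trans (finCongr h))

/-- The multilinear map
`(x₁, …, x_k) ↦ F (x₁, …, x_p) (x_{p+1}, …, x_{p+q}) (x_{p+q+1}, …, x_k)`, where `k = p + q + r`. -/
def join₃ (p q r k : ℕ) (h : p + q + r = k)
    (F : V [⋀^Fin p]→ₗ[K] (V [⋀^Fin q]→ₗ[K] (V [⋀^Fin r]→ₗ[K] N))) :
    MultilinearMap K (fun _ : Fin k => V) N :=
  (((AlternatingMap.toMultilinearMapLM (S := K)).compMultilinearMap
    (join₂ p q (p + q) rfl F)).uncurrySum).domDomCongr (finSumFinEquiv.trans (finCongr h))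

theorem join₂_apply (p q k : ℕ) (h : p + q = k) (F : V [⋀^Fin p]→ₗ[K] (V [⋀^Fin q]→ₗ[K] N))
    (v : Fin k → V) :
    join₂ p q k h F v = F (fun a => v ⟨a, by omega⟩) (fun a => v ⟨p + a, by omega⟩) := by
  subst h; rfl

theorem join₃_apply (p q r k : ℕ) (h : p + q + r = k)
    (F : V [⋀^Fin p]→ₗ[K] (V [⋀^Fin q]→ₗ[K] (V [⋀^Fin r]→ₗ[K] N))) (v : Fin k → V) :
    join₃ p q r k h F v = F (fun a => v ⟨a, by omega⟩) (fun a => v ⟨p + a, by omega⟩)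
      (fun a => v ⟨p + q + a, by omega⟩) := by
  subst h; rfl

theorem join₂_eq_zero (p q k : ℕ) (h : p + q = k) (F : V [⋀^Fin p]→ₗ[K] (V [⋀^Fin q]→ₗ[K] N))
    (v : Fin k → V) (i j : Fin k)
    (hv : v i = v j) (hij : i ≠ j) (hc : block₂ p i = block₂ p j) : join₂ p q k h F v = 0 := by
  subst h
  have e : join₂ p q _ rfl F v = F (fun a => v (Fin.castAdd q a)) (fun a => v (Fin.natAdd p a)) :=
    rfl
  rw [e]
  induction i using Fin.addCases with
  | left i =>
    induction j using Fin.addCases with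
    | left j =>
      rw [AlternatingMap.map_eq_zero_of_eq F _ (i := i) (j := j) hv
        (fun e => hij (by rw [e])), AlternatingMap.zero_apply]
    | right j => simp [block₂] at hc
  | right i =>
    induction j using Fin.addCases with
    | left j => simp [block₂] at hc
    | right j =>
      exact AlternatingMap.map_eq_zero_of_eq _ _ (i := i) (j := j) hv (fun e => hij (by rw [e]))

theorem join₃_eq_zero (p q r k : ℕ) (h : p + q + r = k)
    (F : V [⋀^Fin p]→ₗ[K] (V [⋀^Fin q]→ₗ[K] (V [⋀^Fin r]→ₗ[K] N))) (v : Fin k → V) (i j : Fin k)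
    (hv : v i = v j) (hij : i ≠ j) (hc : block₃ p q i = block₃ p q j) :
    join₃ p q r k h F v = 0 := by
  subst h
  have e : join₃ p q r _ rfl F v = join₂ p q _ rfl F (fun a => v (Fin.castAdd r a))
      (fun a => v (Fin.natAdd (p + q) a)) := rfl
  rw [e]
  induction i using Fin.addCases with
  | left i =>
    induction j using Fin.addCases with
    | left j =>
      rw [join₂_eq_zero p q _ rfl F _ i j hv (fun e => hij (by rw [e])), AlternatingMap.zero_apply]
      have hi := i.isLt
      have hj := j.isLt
      simp only [block₃, block₂, Fin.val_castAdd] at hc ⊢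
      split_ifs at hc ⊢ <;> simp_all
    | right j =>
      have hi := i.isLt
      simp only [block₃, Fin.val_castAdd, Fin.val_natAdd] at hc
      split_ifs at hc <;> omega
  | right i =>
    induction j using Fin.addCases with
    | left j =>
      have hj := j.isLt
      simp only [block₃, Fin.val_castAdd, Fin.val_natAdd] at hc
      split_ifs at hc <;> omega
    | right j =>
      exact AlternatingMap.map_eq_zero_of_eq _ _ (i := i) (j := j) hv (fun e => hij (by rw [e]))

/-- For `k = p + q`, the alternating map
`(x₁, …, x_k) ↦ ∑_{σ ∈ 𝕊_{(p,q)}} (-1)^σ F (x_{σ(1)}, …, x_{σ(p)}) (x_{σ(p+1)}, …, x_{σ(k)})`. -/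
noncomputable def shuffle₂ (p q k : ℕ) (h : p + q = k) :
    (V [⋀^Fin p]→ₗ[K] (V [⋀^Fin q]→ₗ[K] N)) →ₗ[K] (V [⋀^Fin k]→ₗ[K] N) where
  toFun F := shuffleSum (block₂ p) (shuffles₂ p k) (by simp [shuffles₂]) (join₂ p q k h F)
    (join₂_eq_zero p q k h F)
  map_add' F F' := by
    ext v
    simp [shuffleSum_apply, join₂_apply, smul_add, Finset.sum_add_distrib]
  map_smul' c F := by
    ext v
    simp [shuffleSum_apply, join₂_apply, Finset.smul_sum, smul_comm c]

/-- For `k = p + q + r`, the alternating map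
`(x₁, …, x_k) ↦ ∑_{σ ∈ 𝕊_{(p,q,r)}} (-1)^σ F (x_{σ(1)}, …, x_{σ(p)})
  (x_{σ(p+1)}, …, x_{σ(p+q)}) (x_{σ(p+q+1)}, …, x_{σ(k)})`. -/
noncomputable def shuffle₃ (p q r k : ℕ) (h : p + q + r = k) :
    (V [⋀^Fin p]→ₗ[K] (V [⋀^Fin q]→ₗ[K] (V [⋀^Fin r]→ₗ[K] N))) →ₗ[K] (V [⋀^Fin k]→ₗ[K] N) where
  toFun F := shuffleSum (block₃ p q) (shuffles₃ p q k) (by simp [shuffles₃]) (join₃ p q r k h F)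
    (join₃_eq_zero p q r k h F)
  map_add' F F' := by
    ext v
    simp [shuffleSum_apply, join₃_apply, smul_add, Finset.sum_add_distrib]
  map_smul' c F := by
    ext v
    simp [shuffleSum_apply, join₃_apply, Finset.smul_sum, smul_comm c]

theorem shuffle₂_apply (p q k : ℕ) (h : p + q = k) (F : V [⋀^Fin p]→ₗ[K] (V [⋀^Fin q]→ₗ[K] N))
    (v : Fin k → V) :
    shuffle₂ p q k h F v = ∑ σ ∈ shuffles₂ p k, Equiv.Perm.sign σ •
      F (fun a => v (σ ⟨a, by omega⟩)) (fun a => v (σ ⟨p + a, by omega⟩)) := by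
  simp [shuffle₂, shuffleSum_apply, join₂_apply]

theorem shuffle₃_apply (p q r k : ℕ) (h : p + q + r = k)
    (F : V [⋀^Fin p]→ₗ[K] (V [⋀^Fin q]→ₗ[K] (V [⋀^Fin r]→ₗ[K] N))) (v : Fin k → V) :
    shuffle₃ p q r k h F v = ∑ σ ∈ shuffles₃ p q k, Equiv.Perm.sign σ •
      F (fun a => v (σ ⟨a, by omega⟩)) (fun a => v (σ ⟨p + a, by omega⟩))
        (fun a => v (σ ⟨p + q + a, by omega⟩)) := by
  simp [shuffle₃, shuffleSum_apply, join₃_apply]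

/-- Composition of a linear map with an alternating map, as a bilinear operation. -/
def compₗ {p : ℕ} :
    (N →ₗ[K] N') →ₗ[K] (V [⋀^Fin p]→ₗ[K] N) →ₗ[K] (V [⋀^Fin p]→ₗ[K] N') :=
  LinearMap.mk₂ K (fun φ γ => φ.compAlternatingMap γ)
    (fun _ _ _ => rfl) (fun _ _ _ => rfl)
    (fun φ _ _ => by ext; simp) (fun c φ _ => by ext; simp)

@[simp]
theorem compₗ_apply {p : ℕ} (φ : N →ₗ[K] N') (γ : V [⋀^Fin p]→ₗ[K] N) (v : Fin p → V) :
    compₗ φ γ v = φ (γ v) := rfl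

/-- For `φ` in `r' = r + 1` arguments and `γ` in `q` arguments, the insertion of `γ` into the first
argument of `φ`: with `s = q + r`,
`(y₁, …, y_s) ↦ ∑_{τ ∈ 𝕊_{(q,r)}} (-1)^τ
  φ (γ (y_{τ(1)}, …, y_{τ(q)}), y_{τ(q+1)}, …, y_{τ(s)})`. -/
noncomputable def insertion (q r r' s : ℕ) (hr : r' = r + 1) (hs : q + r = s) :
    (V [⋀^Fin r']→ₗ[K] N) →ₗ[K] (V [⋀^Fin q]→ₗ[K] V) →ₗ[K] (V [⋀^Fin s]→ₗ[K] N) :=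
  (compₗ ∘ₗ AlternatingMap.curryLeftLinearMap ∘ₗ (castAlt hr).toLinearMap).compr₂
    (shuffle₂ q r s hs)

theorem insertion_apply (q r r' s : ℕ) (hr : r' = r + 1) (hs : q + r = s)
    (φ : V [⋀^Fin r']→ₗ[K] N) (γ : V [⋀^Fin q]→ₗ[K] V) (y : Fin s → V) :
    insertion q r r' s hr hs φ γ y = ∑ τ ∈ shuffles₂ q s, Equiv.Perm.sign τ •
      castAlt hr φ (Matrix.vecCons (γ (fun a => y (τ ⟨a, by omega⟩)))
        (fun a => y (τ ⟨q + a, by omega⟩))) := by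
  subst hr
  simp [insertion, shuffle₂_apply]

theorem sum_apply' {p : ℕ} {ι : Type*} (S : Finset ι) (F : ι → V [⋀^Fin p]→ₗ[K] N)
    (v : Fin p → V) : (∑ i ∈ S, F i) v = ∑ i ∈ S, F i v := by
  classical
  induction S using Finset.induction_on with
  | empty => simp
  | insert a s ha ih => rw [Finset.sum_insert ha, Finset.sum_insert ha, AlternatingMap.add_apply, ih]

theorem units_smul_apply {p : ℕ} (u : ℤˣ) (F : V [⋀^Fin p]→ₗ[K] N) (v : Fin p → V) :
    (u • F) v = u • F v := rfl

end ShuffleSums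

/-! ### The cochain spaces -/

section Cochains

variable (K V : Type*) [CommRing K] [AddCommGroup V] [Module K V]

/-- `C^n_{postLie}(V, V) = ⊕_{i=0}^{n} Hom(⋀^i V ⊗ ⋀^{n+1-i} V, V)`. An element is a family
`f = (f_0, …, f_n)`, where `f_i` is a map which is alternating in its first `i` arguments and
alternating in its last `n + 1 - i` arguments; by the universal properties of `⋀` and `⊗` this is
the same as a linear map `⋀^i V ⊗ ⋀^{n+1-i} V → V` (see `homEquiv`). -/
def Cochain (n : ℕ) : Type _ :=
  (i : Fin (n + 1)) → V [⋀^Fin (i : ℕ)]→ₗ[K] (V [⋀^Fin (n + 1 - (i : ℕ))]→ₗ[K] V)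

instance (n : ℕ) : AddCommGroup (Cochain K V n) :=
  inferInstanceAs (AddCommGroup
    ((i : Fin (n + 1)) → V [⋀^Fin (i : ℕ)]→ₗ[K] (V [⋀^Fin (n + 1 - (i : ℕ))]→ₗ[K] V)))

instance (n : ℕ) : Module K (Cochain K V n) :=
  inferInstanceAs (Module K
    ((i : Fin (n + 1)) → V [⋀^Fin (i : ℕ)]→ₗ[K] (V [⋀^Fin (n + 1 - (i : ℕ))]→ₗ[K] V)))

/-- Maps which are alternating in the first `p` and in the last `q` arguments are the same as
linear maps on `⋀^p V ⊗ ⋀^q V`. -/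
noncomputable def homEquiv (p q : ℕ) :
    (V [⋀^Fin p]→ₗ[K] (V [⋀^Fin q]→ₗ[K] V)) ≃ₗ[K] (⋀[K]^p V ⊗[K] ⋀[K]^q V →ₗ[K] V) :=
  (exteriorPower.alternatingMapLinearEquiv ≪≫ₗ
    LinearEquiv.congrRight exteriorPower.alternatingMapLinearEquiv) ≪≫ₗ
      TensorProduct.lift.equiv (RingHom.id K) (⋀[K]^p V) (⋀[K]^q V) V

theorem homEquiv_apply (p q : ℕ) (f : V [⋀^Fin p]→ₗ[K] (V [⋀^Fin q]→ₗ[K] V))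
    (x : Fin p → V) (y : Fin q → V) :
    homEquiv K V p q f (exteriorPower.ιMulti K p x ⊗ₜ[K] exteriorPower.ιMulti K q y) = f x y := by
  show exteriorPower.alternatingMapLinearEquiv (exteriorPower.alternatingMapLinearEquiv f
    (exteriorPower.ιMulti K p x)) (exteriorPower.ιMulti K q y) = f x y
  simp

variable {K V}

/-- The component `f_i` of a cochain, for a natural number `i ≤ n`. -/
def Cochain.comp {n : ℕ} (f : Cochain K V n) (i : ℕ) (h : i ≤ n) :
    V [⋀^Fin i]→ₗ[K] (V [⋀^Fin (n + 1 - i)]→ₗ[K] V) :=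
  f ⟨i, Nat.lt_succ_of_le h⟩

theorem Cochain.comp_add {n : ℕ} (f f' : Cochain K V n) (i : ℕ) (h : i ≤ n) :
    (f + f').comp i h = f.comp i h + f'.comp i h := rfl

theorem Cochain.comp_smul {n : ℕ} (c : K) (f : Cochain K V n) (i : ℕ) (h : i ≤ n) :
    (c • f).comp i h = c • f.comp i h := rfl

/-- The sum over `σ ∈ 𝕊_{(j, m+1-j, k-m-1)}` of
`(-1)^σ f_{k-m} (g_j (x_{σ(1)} ⋯ x_{σ(j)} ⊗ x_{σ(j+1)} ⋯ x_{σ(m+1)}) x_{σ(m+2)} ⋯ x_{σ(k)}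
  ⊗ x_{k+1} ⋯ x_{n+m+1})`, as a function of `(x₁, …, x_k)` and `(x_{k+1}, …, x_{n+m+1})`. -/
noncomputable def insertLeft {n m : ℕ} (f : Cochain K V n) (g : Cochain K V m) (k j : ℕ)
    (hk : k ≤ n + m) (hj : j ≤ m) (hmk : m + 1 ≤ k) :
    V [⋀^Fin k]→ₗ[K] (V [⋀^Fin (n + m + 1 - k)]→ₗ[K] V) :=
  compₗ (castAlt (by omega : n + 1 - (k - m) = n + m + 1 - k)).toLinearMap
    (shuffle₃ j (m + 1 - j) (k - m - 1) k (by omega)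
      (compₗ
        (compₗ (AlternatingMap.curryLeftLinearMap
          (castAlt (by omega : k - m = (k - m - 1) + 1) (f.comp (k - m) (by omega)))))
        (g.comp j hj)))

/-- The sum over `σ ∈ 𝕊_{(k-j, j)}` and `τ ∈ 𝕊_{(m+1-j, n+j-k)}` of
`(-1)^σ (-1)^τ (-1)^{m(k-j)} f_{k-j} (x_{σ(1)} ⋯ x_{σ(k-j)} ⊗
  g_j (x_{σ(k-j+1)} ⋯ x_{σ(k)} ⊗ x_{k+τ(1)} ⋯ x_{k+τ(m+1-j)})
    x_{k+τ(m+2-j)} ⋯ x_{k+τ(n+m+1-k)})`,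
as a function of `(x₁, …, x_k)` and `(x_{k+1}, …, x_{n+m+1})`. -/
noncomputable def insertRight {n m : ℕ} (f : Cochain K V n) (g : Cochain K V m) (k j : ℕ)
    (hj : j ≤ m) (hjk : j ≤ k) (hkn : k ≤ n + j) :
    V [⋀^Fin k]→ₗ[K] (V [⋀^Fin (n + m + 1 - k)]→ₗ[K] V) :=
  (-1 : K) ^ (m * (k - j)) •
    shuffle₂ (k - j) j k (by omega)
      (compₗ
        (compₗ.flip (g.comp j hj) ∘ₗ
          insertion (m + 1 - j) (n + j - k) (n + 1 - (k - j)) (n + m + 1 - k)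
            (by omega) (by omega))
        (f.comp (k - j) (by omega)))

theorem insertLeft_apply {n m : ℕ} (f : Cochain K V n) (g : Cochain K V m) (k j : ℕ)
    (hk : k ≤ n + m) (hj : j ≤ m) (hmk : m + 1 ≤ k)
    (x : Fin k → V) (y : Fin (n + m + 1 - k) → V) :
    insertLeft f g k j hk hj hmk x y =
      ∑ σ ∈ shuffles₃ j (m + 1 - j) k, Equiv.Perm.sign σ •
        f.comp (k - m) (by omega)
          (fun a => (Matrix.vecCons
            (g.comp j hj (fun b => x (σ ⟨b, by omega⟩)) (fun b => x (σ ⟨j + b, by omega⟩)))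
            (fun b : Fin (k - m - 1) => x (σ ⟨m + 1 + b, by omega⟩)) : Fin (k - m - 1 + 1) → V)
              (Fin.cast (by omega) a))
          (fun a => y (Fin.cast (by omega) a)) := by
  have hidx : j + (m + 1 - j) = m + 1 := by omega
  simp only [insertLeft, shuffle₃_apply, compₗ_apply, hidx, map_sum, sum_apply']
  refine Finset.sum_congr rfl fun σ _ => ?_
  rw [Units.smul_def, Units.smul_def, map_zsmul]
  rfl

theorem insertRight_apply {n m : ℕ} (f : Cochain K V n) (g : Cochain K V m) (k j : ℕ)
    (hj : j ≤ m) (hjk : j ≤ k) (hkn : k ≤ n + j)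
    (x : Fin k → V) (y : Fin (n + m + 1 - k) → V) :
    insertRight f g k j hj hjk hkn x y =
      ∑ σ ∈ shuffles₂ (k - j) k, ∑ τ ∈ shuffles₂ (m + 1 - j) (n + m + 1 - k),
        Equiv.Perm.sign σ • Equiv.Perm.sign τ • (-1 : K) ^ (m * (k - j)) •
        f.comp (k - j) (by omega) (fun a => x (σ ⟨a, by omega⟩))
          (fun a => (Matrix.vecCons
            (g.comp j hj (fun b => x (σ ⟨k - j + b, by omega⟩)) (fun b => y (τ ⟨b, by omega⟩)))
            (fun b : Fin (n + j - k) => y (τ ⟨m + 1 - j + b, by omega⟩)) :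
              Fin (n + j - k + 1) → V) (Fin.cast (by omega) a)) := by
  simp only [insertRight, AlternatingMap.smul_apply, shuffle₂_apply, compₗ_apply,
    LinearMap.comp_apply, LinearMap.flip_apply, Finset.smul_sum, sum_apply']
  refine Finset.sum_congr rfl fun σ _ => ?_
  rw [insertion_apply, Finset.smul_sum,
    Finset.smul_sum]
  refine Finset.sum_congr rfl fun τ _ => ?_
  rw [smul_comm ((-1 : K) ^ (m * (k - j))), smul_comm ((-1 : K) ^ (m * (k - j)))]
  rfl

theorem insertLeft_add_left {n m : ℕ} (f f' : Cochain K V n) (g : Cochain K V m) (k j : ℕ)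
    (hk : k ≤ n + m) (hj : j ≤ m) (hmk : m + 1 ≤ k) :
    insertLeft (f + f') g k j hk hj hmk = insertLeft f g k j hk hj hmk + insertLeft f' g k j hk hj hmk := by
  simp [insertLeft, Cochain.comp_add]

theorem insertLeft_smul_left {n m : ℕ} (c : K) (f : Cochain K V n) (g : Cochain K V m) (k j : ℕ)
    (hk : k ≤ n + m) (hj : j ≤ m) (hmk : m + 1 ≤ k) :
    insertLeft (c • f) g k j hk hj hmk = c • insertLeft f g k j hk hj hmk := by
  simp [insertLeft, Cochain.comp_smul]

theorem insertRight_add_left {n m : ℕ} (f f' : Cochain K V n) (g : Cochain K V m) (k j : ℕ)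
    (hj : j ≤ m) (hjk : j ≤ k) (hkn : k ≤ n + j) :
    insertRight (f + f') g k j hj hjk hkn = insertRight f g k j hj hjk hkn + insertRight f' g k j hj hjk hkn := by
  simp [insertRight, Cochain.comp_add, smul_add]

theorem insertRight_smul_left {n m : ℕ} (c : K) (f : Cochain K V n) (g : Cochain K V m) (k j : ℕ)
    (hj : j ≤ m) (hjk : j ≤ k) (hkn : k ≤ n + j) :
    insertRight (c • f) g k j hj hjk hkn = c • insertRight f g k j hj hjk hkn := by
  simp [insertRight, Cochain.comp_smul, smul_comm c]

theorem insertLeft_add_right {n m : ℕ} (f : Cochain K V n) (g g' : Cochain K V m) (k j : ℕ)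
    (hk : k ≤ n + m) (hj : j ≤ m) (hmk : m + 1 ≤ k) :
    insertLeft f (g + g') k j hk hj hmk = insertLeft f g k j hk hj hmk + insertLeft f g' k j hk hj hmk := by
  simp [insertLeft, Cochain.comp_add]

theorem insertLeft_smul_right {n m : ℕ} (c : K) (f : Cochain K V n) (g : Cochain K V m) (k j : ℕ)
    (hk : k ≤ n + m) (hj : j ≤ m) (hmk : m + 1 ≤ k) :
    insertLeft f (c • g) k j hk hj hmk = c • insertLeft f g k j hk hj hmk := by
  simp [insertLeft, Cochain.comp_smul]

theorem insertRight_add_right {n m : ℕ} (f : Cochain K V n) (g g' : Cochain K V m) (k j : ℕ)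
    (hj : j ≤ m) (hjk : j ≤ k) (hkn : k ≤ n + j) :
    insertRight f (g + g') k j hj hjk hkn = insertRight f g k j hj hjk hkn + insertRight f g' k j hj hjk hkn := by
  simp [insertRight, Cochain.comp_add, smul_add, LinearMap.add_comp]

theorem insertRight_smul_right {n m : ℕ} (c : K) (f : Cochain K V n) (g : Cochain K V m) (k j : ℕ)
    (hj : j ≤ m) (hjk : j ≤ k) (hkn : k ≤ n + j) :
    insertRight f (c • g) k j hj hjk hkn = c • insertRight f g k j hj hjk hkn := by
  simp [insertRight, Cochain.comp_smul, smul_comm c, LinearMap.smul_comp]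

/-- The composition `f ∘ g = ((f ∘ g)_0, …, (f ∘ g)_{n+m})`. The first sum is present only for
`m + 1 ≤ k`. In the second sum `j` runs over `0 ≤ j ≤ min(k, m)`; a term with `k - j > n` is absent,
since there is no component `f_{k-j}` (and no shuffle `τ`, as `n + j - k < 0`). -/
noncomputable def circFun {n m : ℕ} (f : Cochain K V n) (g : Cochain K V m) :
    Cochain K V (n + m) := fun k =>
  (if hmk : m + 1 ≤ (k : ℕ) then
    ∑ j : Fin (m + 1), insertLeft f g k j (Nat.le_of_lt_succ k.isLt) (Nat.le_of_lt_succ j.isLt) hmk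
  else 0) +
  ∑ j : Fin (m + 1),
    if h : (j : ℕ) ≤ (k : ℕ) ∧ (k : ℕ) ≤ n + j then
      insertRight f g k j (Nat.le_of_lt_succ j.isLt) h.1 h.2
    else 0

variable (K V)

/-- The composition `f ∘ g` as a bilinear map. -/
noncomputable def circ (n m : ℕ) : Cochain K V n →ₗ[K] Cochain K V m →ₗ[K] Cochain K V (n + m) :=
  LinearMap.mk₂ K circFun
    (fun f f' g => by
      funext k
      show circFun (f + f') g k = circFun f g k + circFun f' g k
      simp only [circFun, insertLeft_add_left, insertRight_add_left]
      rw [add_add_add_comm]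
      congr 1
      · split_ifs <;> simp [Finset.sum_add_distrib]
      · rw [← Finset.sum_add_distrib]
        exact Finset.sum_congr rfl fun j _ => by split_ifs <;> simp)
    (fun c f g => by
      funext k
      show circFun (c • f) g k = c • circFun f g k
      simp only [circFun, insertLeft_smul_left, insertRight_smul_left]
      rw [smul_add]
      congr 1
      · split_ifs <;> simp [Finset.smul_sum]
      · rw [Finset.smul_sum]
        exact Finset.sum_congr rfl fun j _ => by split_ifs <;> simp)
    (fun f g g' => by
      funext k
      show circFun f (g + g') k = circFun f g k + circFun f g' k
      simp only [circFun, insertLeft_add_right, insertRight_add_right]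
      rw [add_add_add_comm]
      congr 1
      · split_ifs <;> simp [Finset.sum_add_distrib]
      · rw [← Finset.sum_add_distrib]
        exact Finset.sum_congr rfl fun j _ => by split_ifs <;> simp)
    (fun c f g => by
      funext k
      show circFun f (c • g) k = c • circFun f g k
      simp only [circFun, insertLeft_smul_right, insertRight_smul_right]
      rw [smul_add]
      congr 1
      · split_ifs <;> simp [Finset.smul_sum]
      · rw [Finset.smul_sum]
        exact Finset.sum_congr rfl fun j _ => by split_ifs <;> simp)

end Cochains

/-! ### Graded Lie algebras and Maurer-Cartan elements -/

section GradedLie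

variable {K : Type*} [CommRing K] {L : ℕ → Type*} [∀ n, AddCommGroup (L n)] [∀ n, Module K (L n)]

/-- A bilinear map `[·, ·]` on a graded vector space `L = ⊕_n L^n` is a graded Lie bracket if it has
degree `0`, is graded skew-symmetric, `[f, g] = -(-1)^{nm} [g, f]`, and satisfies the graded Jacobi
identity, `[f, [g, h]] = [[f, g], h] + (-1)^{nm} [g, [f, h]]`, for `f ∈ L^n`, `g ∈ L^m`, `h ∈ L^l`. -/
structure IsGradedLieBracket
    (br : (⨁ n, L n) →ₗ[K] (⨁ n, L n) →ₗ[K] (⨁ n, L n)) : Prop where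
  degree : ∀ (n m : ℕ) (f : L n) (g : L m), ∃ h : L (n + m),
    br (DirectSum.lof K ℕ L n f) (DirectSum.lof K ℕ L m g) = DirectSum.lof K ℕ L (n + m) h
  skew : ∀ (n m : ℕ) (f : L n) (g : L m),
    br (DirectSum.lof K ℕ L n f) (DirectSum.lof K ℕ L m g) =
      -((-1 : K) ^ (n * m) • br (DirectSum.lof K ℕ L m g) (DirectSum.lof K ℕ L n f))
  jacobi : ∀ (n m l : ℕ) (f : L n) (g : L m) (h : L l),
    br (DirectSum.lof K ℕ L n f)
        (br (DirectSum.lof K ℕ L m g) (DirectSum.lof K ℕ L l h)) =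
      br (br (DirectSum.lof K ℕ L n f) (DirectSum.lof K ℕ L m g)) (DirectSum.lof K ℕ L l h) +
      (-1 : K) ^ (n * m) •
        br (DirectSum.lof K ℕ L m g) (br (DirectSum.lof K ℕ L n f) (DirectSum.lof K ℕ L l h))

/-- A Maurer-Cartan element of a graded Lie algebra is an element `π` of degree `1` such that
`[π, π] = 0`. -/
def IsMaurerCartan (br : (⨁ n, L n) →ₗ[K] (⨁ n, L n) →ₗ[K] (⨁ n, L n)) (π : L 1) : Prop :=
  br (DirectSum.lof K ℕ L 1 π) (DirectSum.lof K ℕ L 1 π) = 0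

end GradedLie

section Bracket

variable (K V : Type*) [CommRing K] [AddCommGroup V] [Module K V]

/-- `[f, g] = f ∘ g - (-1)^{nm} g ∘ f` for `f` of degree `n` and `g` of degree `m`. -/
noncomputable def homogeneousBracket (n m : ℕ) :
    Cochain K V n →ₗ[K] Cochain K V m →ₗ[K] ⨁ l, Cochain K V l :=
  (circ K V n m).compr₂ (DirectSum.lof K ℕ (Cochain K V) (n + m)) -
    (-1 : K) ^ (n * m) • (circ K V m n).flip.compr₂ (DirectSum.lof K ℕ (Cochain K V) (m + n))

/-- The bracket `[·, ·]_{postLie}` on `C^*_{postLie}(V, V) = ⊕_n C^n_{postLie}(V, V)`, the bilinear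
extension of `[f, g] = f ∘ g - (-1)^{nm} g ∘ f`. -/
noncomputable def bracket :
    (⨁ n, Cochain K V n) →ₗ[K] (⨁ n, Cochain K V n) →ₗ[K] (⨁ n, Cochain K V n) :=
  DirectSum.toModule K ℕ _ fun n =>
    (DirectSum.toModule K ℕ _ fun m => (homogeneousBracket K V n m).flip).flip

variable {K V}

theorem bracket_lof (n m : ℕ) (f : Cochain K V n) (g : Cochain K V m) :
    bracket K V (DirectSum.lof K ℕ (Cochain K V) n f) (DirectSum.lof K ℕ (Cochain K V) m g) =
      DirectSum.lof K ℕ (Cochain K V) (n + m) (circ K V n m f g) -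
        (-1 : K) ^ (n * m) • DirectSum.lof K ℕ (Cochain K V) (m + n) (circ K V m n g f) := by
  simp [bracket, homogeneousBracket]

end Bracket

/-- A post-Lie algebra structure on a vector space `V`: a Lie bracket `[·, ·]` and a product `▷`
with `x ▷ [y, z] = [x ▷ y, z] + [y, x ▷ z]` and
`([x, y] + x ▷ y - y ▷ x) ▷ z = x ▷ (y ▷ z) - y ▷ (x ▷ z)`. -/
structure PostLieStructure (K V : Type*) [CommRing K] [AddCommGroup V] [Module K V] where
  lie : V →ₗ[K] V →ₗ[K] V
  lie_self : ∀ x, lie x x = 0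
  lie_jacobi : ∀ x y z, lie x (lie y z) + lie y (lie z x) + lie z (lie x y) = 0
  prod : V →ₗ[K] V →ₗ[K] V
  prod_lie : ∀ x y z, prod x (lie y z) = lie (prod x y) z + lie y (prod x z)
  lie_prod : ∀ x y z,
    prod (lie x y + prod x y - prod y x) z = prod x (prod y z) - prod y (prod x z)

end PostLie

/-!
A cochain `f` of degree `n` takes `i` left and `n + 1 - i` right arguments. Read the left arguments
in the first and the right arguments in the second summand of `V × V`. Then `f` gives an alternating
map `double f` on `V × V` in `n + 1` arguments: its second component is the sum of all `f_i`,
shuffled over the arguments, and its first component is the same sum taken in the first components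
of the arguments only. The definition of `f ∘ g` says that `double (f ∘ g)` is the
Nijenhuis–Richardson product of `double f` and `double g`: in the first sum `A_k` the value of
`double g` is used as a left argument of `f`, in the second sum `B_k` as a right argument. As
`double` is injective, the graded Jacobi identity follows from the fact that the Nijenhuis–Richardson
product is a graded pre-Lie product (`associator_symm`).

The comparison and the pre-Lie identity are proved for functions of lists, which have
no fixed number of arguments, so that all degrees are treated at once. A signed sum over shuffles
becomes a signed sum over the splittings of a list (`unshuffle`), which is defined by recursion;
`sum_shuffles₃` identifies it with the sum over permutations. The contraction with a vector is a
derivation of each of the products (`contract_insertInto`, `contractLeft_insertRightArg` and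
similar lemmas), hence both identities follow by induction on the number of arguments
(`associator_symm`, `hat_insert`).

For `π` of degree `1`, `[π, π] = 2 (π ∘ π)`, and the three components of `π ∘ π` are the Jacobi
identity of `π₀` and the two identities between `π₀` and `π₁` in the definition of a post-Lie
algebra (`circ_self_eq_zero_iff`). Since `2` is invertible, Maurer–Cartan elements are
post-Lie structures.
-/

namespace PostLie

/-! ### Signed sums over the splittings of a list -/

section Unshuffle

variable {X Y N N' : Type*} [AddCommGroup N] [AddCommGroup N']

/-- The signed sum of `G a b` over all ways to split the list `l` into two complementary
subsequences `a` and `b`; the sign is that of the shuffle which restores `l` from `a ++ b`. -/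
def unshuffle : (List X → List X → N) → List X → N
  | G, [] => G [] []
  | G, x :: l => unshuffle (fun a b => G (x :: a) b) l +
      unshuffle (fun a b => (-1 : ℤ) ^ a.length • G a (x :: b)) l

@[simp]
theorem unshuffle_nil (G : List X → List X → N) : unshuffle G [] = G [] [] := rfl

theorem unshuffle_cons (G : List X → List X → N) (x : X) (l : List X) :
    unshuffle G (x :: l) = unshuffle (fun a b => G (x :: a) b) l +
      unshuffle (fun a b => (-1 : ℤ) ^ a.length • G a (x :: b)) l := rfl

theorem unshuffle_congr {G G' : List X → List X → N} (l : List X)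
    (h : ∀ a b, a.length + b.length = l.length → G a b = G' a b) :
    unshuffle G l = unshuffle G' l := by
  induction l generalizing G G' with
  | nil => exact h [] [] rfl
  | cons x l ih =>
    rw [unshuffle_cons, unshuffle_cons]
    congr 1
    · exact ih fun a b hab => h _ _ (by simp only [List.length_cons]; omega)
    · exact ih fun a b hab => by rw [h _ _ (by simp only [List.length_cons]; omega)]

theorem unshuffle_add (G G' : List X → List X → N) (l : List X) :
    unshuffle (fun a b => G a b + G' a b) l = unshuffle G l + unshuffle G' l := by
  induction l generalizing G G' with
  | nil => rfl
  | cons x l ih =>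
    simp only [unshuffle_cons, smul_add, ih]
    abel

theorem map_unshuffle (φ : N →+ N') (G : List X → List X → N) (l : List X) :
    φ (unshuffle G l) = unshuffle (fun a b => φ (G a b)) l := by
  induction l generalizing G with
  | nil => rfl
  | cons x l ih => simp only [unshuffle_cons, map_add, ih, map_zsmul]

theorem unshuffle_zsmul (n : ℤ) (G : List X → List X → N) (l : List X) :
    unshuffle (fun a b => n • G a b) l = n • unshuffle G l :=
  (map_unshuffle (DistribSMul.toAddMonoidHom N n) G l).symm

theorem unshuffle_neg (G : List X → List X → N) (l : List X) :
    unshuffle (fun a b => - G a b) l = - unshuffle G l :=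
  (map_unshuffle (negAddMonoidHom : N →+ N) G l).symm

theorem unshuffle_sub (G G' : List X → List X → N) (l : List X) :
    unshuffle (fun a b => G a b - G' a b) l = unshuffle G l - unshuffle G' l := by
  simp only [sub_eq_add_neg, unshuffle_add, unshuffle_neg]

@[simp]
theorem unshuffle_zero (l : List X) : unshuffle (fun _ _ => (0 : N)) l = 0 := by
  induction l with
  | nil => rfl
  | cons x l ih => simp [unshuffle_cons, ih]

theorem unshuffle_sum {ι : Type*} (S : Finset ι) (G : ι → List X → List X → N) (l : List X) :
    unshuffle (fun a b => ∑ i ∈ S, G i a b) l = ∑ i ∈ S, unshuffle (G i) l := by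
  classical
  induction S using Finset.induction_on with
  | empty => simp
  | insert i S hi ih => simp only [Finset.sum_insert hi, unshuffle_add, ih]

theorem unshuffle_list_map (e : X → Y) (G : List Y → List Y → N) (l : List X) :
    unshuffle G (l.map e) = unshuffle (fun a b => G (a.map e) (b.map e)) l := by
  induction l generalizing G with
  | nil => rfl
  | cons x l ih => simp only [List.map_cons, unshuffle_cons, ih, List.length_map]

/-- The signed sum of `G a b c` over all ways to split the list `l` into three complementary
subsequences `a`, `b` and `c`. -/
def unshuffle₃ : (List X → List X → List X → N) → List X → N
  | G, [] => G [] [] []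
  | G, x :: l => unshuffle₃ (fun a b c => G (x :: a) b c) l +
      unshuffle₃ (fun a b c => (-1 : ℤ) ^ a.length • G a (x :: b) c) l +
      unshuffle₃ (fun a b c => (-1 : ℤ) ^ (a.length + b.length) • G a b (x :: c)) l

theorem unshuffle₃_cons (G : List X → List X → List X → N) (x : X) (l : List X) :
    unshuffle₃ G (x :: l) = unshuffle₃ (fun a b c => G (x :: a) b c) l +
      unshuffle₃ (fun a b c => (-1 : ℤ) ^ a.length • G a (x :: b) c) l +
      unshuffle₃ (fun a b c => (-1 : ℤ) ^ (a.length + b.length) • G a b (x :: c)) l := rfl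

theorem unshuffle₃_congr {G G' : List X → List X → List X → N} (l : List X)
    (h : ∀ a b c, a.length + b.length + c.length = l.length → G a b c = G' a b c) :
    unshuffle₃ G l = unshuffle₃ G' l := by
  induction l generalizing G G' with
  | nil => exact h [] [] [] rfl
  | cons x l ih =>
    rw [unshuffle₃_cons, unshuffle₃_cons]
    congr 1
    · congr 1
      · exact ih fun a b c hab => h _ _ _ (by simp only [List.length_cons]; omega)
      · exact ih fun a b c hab => by rw [h _ _ _ (by simp only [List.length_cons]; omega)]
    · exact ih fun a b c hab => by rw [h _ _ _ (by simp only [List.length_cons]; omega)]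

theorem unshuffle₃_add (G G' : List X → List X → List X → N) (l : List X) :
    unshuffle₃ (fun a b c => G a b c + G' a b c) l = unshuffle₃ G l + unshuffle₃ G' l := by
  induction l generalizing G G' with
  | nil => rfl
  | cons x l ih =>
    simp only [unshuffle₃_cons, smul_add, ih]
    abel

@[simp]
theorem unshuffle₃_zero (l : List X) : unshuffle₃ (fun _ _ _ => (0 : N)) l = 0 := by
  induction l with
  | nil => rfl
  | cons x l ih => simp [unshuffle₃_cons, ih]

theorem unshuffle₃_sum {ι : Type*} (S : Finset ι) (G : ι → List X → List X → List X → N)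
    (l : List X) :
    unshuffle₃ (fun a b c => ∑ i ∈ S, G i a b c) l = ∑ i ∈ S, unshuffle₃ (G i) l := by
  classical
  induction S using Finset.induction_on with
  | empty => simp
  | insert i S hi ih => simp only [Finset.sum_insert hi, unshuffle₃_add, ih]

/-- Splitting a list in two and then splitting the first part in two is splitting it in three. -/
theorem unshuffle_unshuffle (G : List X → List X → List X → N) (l : List X) :
    unshuffle (fun u c => unshuffle (fun a b => G a b c) u) l = unshuffle₃ G l := by
  induction l generalizing G with
  | nil => rfl
  | cons x l ih =>
    simp only [unshuffle_cons, unshuffle_add, unshuffle₃_cons, ih]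
    congr 1
    rw [← ih]
    refine unshuffle_congr l fun u c _ => ?_
    rw [← unshuffle_zsmul]
    exact unshuffle_congr u fun a b hab => by rw [hab]

/-- The splittings in three parts with empty third part are the splittings in two parts. -/
theorem unshuffle₃_ite_nil (G : List X → List X → N) (l : List X) :
    unshuffle₃ (fun a b c => if c.length = 0 then G a b else 0) l = unshuffle G l := by
  induction l generalizing G with
  | nil => rfl
  | cons x l ih =>
    simp only [unshuffle₃_cons, unshuffle_cons, ← ih, List.length_cons, Nat.add_eq_zero_iff,
      one_ne_zero, and_false, if_false, smul_zero, unshuffle₃_zero, add_zero, smul_ite]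

end Unshuffle

/-! ### The Nijenhuis–Richardson product on functions of lists -/

section NijenhuisRichardson

variable {W N : Type*} [AddCommGroup N]

/-- The function `f` with its first argument fixed to be `x`. -/
def contract (x : W) (f : List W → N) : List W → N := fun l => f (x :: l)

/-- The grading automorphism: multiplication by the parity of the number of arguments. -/
def grade (f : List W → N) : List W → N := fun l => (-1 : ℤ) ^ l.length • f l

/-- The Nijenhuis–Richardson product: `g` is inserted in the first argument of `f`, and the
arguments are distributed in all possible ways. -/
def insertInto (f : List W → N) (g : List W → W) : List W → N :=
  unshuffle fun a b => f (g a :: b)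

/-- The function `g` vanishes unless the number of its arguments has the parity of `m + 1`, as for a
map of degree `m`. -/
def HasParity (m : ℕ) (g : List W → N) : Prop := ∀ l, Even (l.length + m) → g l = 0

section

variable {f f' : List W → N} {g : List W → W}

@[simp]
theorem insertInto_nil : insertInto f g [] = f [g []] := rfl

theorem insertInto_add_left : insertInto (f + f') g = insertInto f g + insertInto f' g :=
  funext fun l => unshuffle_add _ _ l

theorem insertInto_neg_left : insertInto (-f) g = - insertInto f g :=
  funext fun l => unshuffle_neg _ l

theorem insertInto_sub_left : insertInto (f - f') g = insertInto f g - insertInto f' g :=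
  funext fun l => unshuffle_sub _ _ l

theorem insertInto_zsmul_left (n : ℤ) : insertInto (n • f) g = n • insertInto f g :=
  funext fun l => unshuffle_zsmul n _ l

end

theorem contract_grade (x : W) (f : List W → N) :
    contract x (grade f) = - grade (contract x f) := by
  funext l
  simp [contract, grade, pow_succ]

theorem grade_grade (f : List W → N) : grade (grade f) = f := by
  funext l
  simp only [grade, smul_smul, ← mul_pow]
  simp

theorem HasParity.contract {m : ℕ} {g : List W → N} (hg : HasParity m g) (x : W) :
    HasParity (m + 1) (contract x g) := fun l hl => hg (x :: l) (by
  rw [List.length_cons, add_right_comm]; exact hl)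

theorem HasParity.grade {m : ℕ} {g : List W → N} (hg : HasParity m g) :
    HasParity m (grade g) := fun l hl => by simp [PostLie.grade, hg l hl]

theorem HasParity.grade_eq {m : ℕ} {g : List W → N} (hg : HasParity m g) :
    PostLie.grade g = (-1 : ℤ) ^ (m + 1) • g := by
  funext l
  by_cases h : Even (l.length + m)
  · simp [PostLie.grade, hg l h]
  · have : (-1 : ℤ) ^ l.length = (-1 : ℤ) ^ (m + 1) := by
      rw [Nat.not_even_iff_odd] at h
      have h2 : Even (l.length + (m + 1)) := by rw [← add_assoc]; exact h.add_one
      rcases Nat.even_or_odd (m + 1) with e | e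
      · rw [e.neg_one_pow, ((Nat.even_add.1 h2).2 e).neg_one_pow]
      · rw [e.neg_one_pow, ((Nat.even_add'.1 h2).2 e).neg_one_pow]
    simp [PostLie.grade, this]

variable [AddCommGroup W]

/-- A function of a list of vectors is alternating if it is additive in every entry and changes
its sign when two neighbouring entries are exchanged. All lengths are treated at once, so that such
a function is a family with one map for each number of arguments. If `N` has `2`-torsion, this is
only skew-symmetry, which suffices for the identities between products. -/
structure IsAlternating (f : List W → N) : Prop where
  map_add : ∀ l x y l', f (l ++ (x + y) :: l') = f (l ++ x :: l') + f (l ++ y :: l')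
  map_swap : ∀ l x y l', f (l ++ x :: y :: l') = - f (l ++ y :: x :: l')

namespace IsAlternating

variable {f f' : List W → N}

theorem map_add_head (hf : IsAlternating f) (x y : W) (l : List W) :
    f ((x + y) :: l) = f (x :: l) + f (y :: l) := hf.map_add [] x y l

theorem map_swap_head (hf : IsAlternating f) (x y : W) (l : List W) :
    f (x :: y :: l) = - f (y :: x :: l) := hf.map_swap [] x y l

/-- The first argument of an alternating function, as a homomorphism. -/
def head (hf : IsAlternating f) (l : List W) : W →+ N :=
  AddMonoidHom.mk' (fun x => f (x :: l)) fun x y => hf.map_add_head x y l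

theorem map_zsmul_head (hf : IsAlternating f) (n : ℤ) (x : W) (l : List W) :
    f ((n • x) :: l) = n • f (x :: l) := _root_.map_zsmul (hf.head l) n x

theorem map_zero_head (hf : IsAlternating f) (l : List W) : f (0 :: l) = 0 :=
  _root_.map_zero (hf.head l)

protected theorem contract (hf : IsAlternating f) (x : W) : IsAlternating (contract x f) where
  map_add l := hf.map_add (x :: l)
  map_swap l := hf.map_swap (x :: l)

protected theorem grade (hf : IsAlternating f) : IsAlternating (grade f) where
  map_add l x y l' := by simp [grade, hf.map_add, smul_add]
  map_swap l x y l' := by simp only [grade, hf.map_swap l x y l', List.length_append,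
    List.length_cons, smul_neg]

protected theorem add (hf : IsAlternating f) (hf' : IsAlternating f') :
    IsAlternating (f + f') where
  map_add l x y l' := by simp only [Pi.add_apply, hf.map_add, hf'.map_add]; abel
  map_swap l x y l' := by
    simp only [Pi.add_apply, hf.map_swap l x y, hf'.map_swap l x y]; abel

protected theorem zsmul (hf : IsAlternating f) (n : ℤ) : IsAlternating (n • f) where
  map_add l x y l' := by simp only [Pi.smul_apply, hf.map_add, smul_add]
  map_swap l x y l' := by simp only [Pi.smul_apply, hf.map_swap l x y, smul_neg]

end IsAlternating

section insertInto

variable {f f' : List W → N} {g g' h : List W → W}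

theorem insertInto_add_right (hf : IsAlternating f) :
    insertInto f (g + g') = insertInto f g + insertInto f g' := by
  funext l
  simp only [insertInto, Pi.add_apply, hf.map_add_head, unshuffle_add]

theorem insertInto_zsmul_right (hf : IsAlternating f) (n : ℤ) :
    insertInto f (n • g) = n • insertInto f g := by
  funext l
  simp only [insertInto, Pi.smul_apply, hf.map_zsmul_head, unshuffle_zsmul]

theorem insertInto_neg_right (hf : IsAlternating f) :
    insertInto f (-g) = - insertInto f g := by
  simpa using insertInto_zsmul_right (g := g) hf (-1)

theorem insertInto_sub_right (hf : IsAlternating f) :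
    insertInto f (g - g') = insertInto f g - insertInto f g' := by
  rw [sub_eq_add_neg, insertInto_add_right hf, insertInto_neg_right hf, ← sub_eq_add_neg]

/-- The contraction with a vector is a graded derivation of the product. Since a function of lists
is determined by its value at the empty list and its contractions, identities between products
follow from this by induction on the number of arguments. -/
theorem contract_insertInto (hf : IsAlternating f) (x : W) :
    contract x (insertInto f g) =
      insertInto f (contract x g) - insertInto (contract x f) (grade g) := by
  funext l
  show insertInto f g (x :: l) = _
  rw [insertInto, unshuffle_cons, sub_eq_add_neg, Pi.add_apply, Pi.neg_apply]
  congr 1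
  rw [insertInto, ← unshuffle_neg]
  refine unshuffle_congr l fun a b _ => ?_
  simp only [contract, grade]
  -- Exchanging `x` with the value of `g` gives the minus sign.
  rw [hf.map_swap_head x, neg_neg, hf.map_zsmul_head]

theorem grade_insertInto (hf : IsAlternating f) :
    grade (insertInto f g) = - insertInto (grade f) (grade g) := by
  funext l
  simp only [grade, insertInto, Pi.neg_apply]
  rw [← unshuffle_zsmul, ← unshuffle_neg]
  refine unshuffle_congr l fun a b hab => ?_
  rw [hf.map_zsmul_head, smul_smul, ← neg_smul, ← hab, List.length_cons]
  congr 1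
  ring

/-- The Nijenhuis–Richardson product of alternating functions is alternating. -/
protected theorem IsAlternating.insertInto (hf : IsAlternating f) (hg : IsAlternating g) :
    IsAlternating (insertInto f g) where
  map_add l x y l' := by
    induction l generalizing f g with
    | nil =>
      have e : PostLie.contract (x + y) (PostLie.insertInto f g) =
          PostLie.contract x (PostLie.insertInto f g) +
            PostLie.contract y (PostLie.insertInto f g) := by
        have e1 : PostLie.contract (x + y) g = PostLie.contract x g + PostLie.contract y g :=
          funext (hg.map_add_head x y)
        have e2 : PostLie.contract (x + y) f = PostLie.contract x f + PostLie.contract y f :=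
          funext (hf.map_add_head x y)
        rw [contract_insertInto hf, contract_insertInto hf, contract_insertInto hf, e1, e2,
          insertInto_add_right hf, insertInto_add_left]
        abel
      exact congrFun e l'
    | cons z l ih =>
      have e : ∀ u, PostLie.insertInto f g (z :: u) =
          PostLie.insertInto f (PostLie.contract z g) u -
            PostLie.insertInto (PostLie.contract z f) (PostLie.grade g) u :=
        fun u => congrFun (contract_insertInto hf z) u
      simp only [List.cons_append, e, ih hf (hg.contract z), ih (hf.contract z) hg.grade]
      abel
  map_swap l x y l' := by
    induction l generalizing f g with
    | nil =>
      have e : ∀ x y, PostLie.contract y (PostLie.contract x (PostLie.insertInto f g)) =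
          PostLie.insertInto f (PostLie.contract y (PostLie.contract x g)) -
          PostLie.insertInto (PostLie.contract y f) (PostLie.grade (PostLie.contract x g)) +
          PostLie.insertInto (PostLie.contract x f) (PostLie.grade (PostLie.contract y g)) +
          PostLie.insertInto (PostLie.contract y (PostLie.contract x f)) g := by
        intro x y
        have e0 : ∀ u v : List W → N, PostLie.contract y (u - v) =
          PostLie.contract y u - PostLie.contract y v := fun _ _ => rfl
        rw [contract_insertInto hf, e0, contract_insertInto hf,
          contract_insertInto (hf.contract x), contract_grade, grade_grade,
          insertInto_neg_right (hf.contract x)]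
        abel
      have e1 : PostLie.contract y (PostLie.contract x g) =
          - PostLie.contract x (PostLie.contract y g) := funext (hg.map_swap_head x y)
      have e2 : PostLie.contract y (PostLie.contract x f) =
          - PostLie.contract x (PostLie.contract y f) := funext (hf.map_swap_head x y)
      have e3 : PostLie.contract y (PostLie.contract x (PostLie.insertInto f g)) =
          - PostLie.contract x (PostLie.contract y (PostLie.insertInto f g)) := by
        rw [e, e, e1, e2, insertInto_neg_right hf, insertInto_neg_left]
        abel
      exact congrFun e3 l'
    | cons z l ih =>
      have e : ∀ u, PostLie.insertInto f g (z :: u) =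
          PostLie.insertInto f (PostLie.contract z g) u -
            PostLie.insertInto (PostLie.contract z f) (PostLie.grade g) u :=
        fun u => congrFun (contract_insertInto hf z) u
      simp only [List.cons_append, e]
      rw [ih hf (hg.contract z), ih (hf.contract z) hg.grade]
      abel

/-- The associator of the Nijenhuis–Richardson product. -/
def associator (f : List W → N) (g h : List W → W) : List W → N :=
  insertInto (insertInto f g) h - insertInto f (insertInto g h)

theorem contract_associator (hf : IsAlternating f) (hg : IsAlternating g) (x : W) :
    contract x (associator f g h) = associator f g (contract x h) -
      associator f (contract x g) (grade h) + associator (contract x f) (grade g) (grade h) := by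
  have e0 : ∀ u v : List W → N, contract x (u - v) = contract x u - contract x v := fun _ _ => rfl
  rw [associator, e0, contract_insertInto (hf.insertInto hg), contract_insertInto hf,
    contract_insertInto hf, contract_insertInto hg, insertInto_sub_left, insertInto_sub_right hf,
    grade_insertInto hg, insertInto_neg_right (hf.contract x)]
  simp only [associator]
  abel

/-- Without arguments, only the term remains in which `g` and `h` are inserted side by side. -/
theorem associator_nil :
    associator f g h [] = f [g [], h []] := by
  simp [associator, insertInto, unshuffle_cons]

theorem associator_zsmul_left (hf : IsAlternating f) (n : ℤ) :
    associator f (n • g) h = n • associator f g h := by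
  rw [associator, insertInto_zsmul_right hf, insertInto_zsmul_left, insertInto_zsmul_left,
    insertInto_zsmul_right hf, associator, smul_sub]

theorem associator_zsmul_right (hf : IsAlternating f) (hg : IsAlternating g) (n : ℤ) :
    associator f g (n • h) = n • associator f g h := by
  rw [associator, insertInto_zsmul_right (hf.insertInto hg), insertInto_zsmul_right hg,
    insertInto_zsmul_right hf, associator, smul_sub]

/-- The Nijenhuis–Richardson product is a graded right pre-Lie product. Both sides have the same
contractions by induction, and for `g` and `h` without arguments the associator is
`f (g, h, …)`, which is skew-symmetric. -/
theorem associator_symm (hf : IsAlternating f) (hg : IsAlternating g) (hh : IsAlternating h)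
    {m k : ℕ} (pg : HasParity m g) (ph : HasParity k h) :
    associator f g h = (-1 : ℤ) ^ (m * k) • associator f h g := by
  funext l
  induction l generalizing f g h m k with
  | nil =>
    rw [Pi.smul_apply, associator_nil, associator_nil]
    by_cases em : Even m
    · rw [pg [] (by simpa using em), hf.map_zero_head, hf.map_swap_head, hf.map_zero_head]
      simp
    by_cases ek : Even k
    · rw [ph [] (by simpa using ek), hf.map_zero_head, hf.map_swap_head, hf.map_zero_head]
      simp
    -- Here `g` and `h` both have odd degree, as maps without arguments have.
    · rw [Nat.not_even_iff_odd] at em ek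
      rw [(em.mul ek).neg_one_pow, hf.map_swap_head]
      simp
  | cons x l ih =>
    have e1 : ∀ u, associator f g h (x :: u) = _ := fun u => congrFun
      (contract_associator (h := h) hf hg x) u
    have e2 : ∀ u, associator f h g (x :: u) = _ := fun u => congrFun
      (contract_associator (h := g) hf hh x) u
    rw [Pi.smul_apply, e1, e2]
    simp only [Pi.add_apply, Pi.sub_apply]
    rw [ih hf hg (hh.contract x) pg (ph.contract x),
      ih hf (hg.contract x) hh.grade (pg.contract x) ph.grade,
      ih (hf.contract x) hg.grade hh.grade pg.grade ph.grade,
      ph.grade_eq, pg.grade_eq, associator_zsmul_left hf, associator_zsmul_right hf (hh.contract x)]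
    simp only [Pi.smul_apply]
    have s1 : (-1 : ℤ) ^ (m * (k + 1)) = (-1) ^ (m * k) * (-1) ^ m := by ring
    have s2 : (-1 : ℤ) ^ ((m + 1) * k) = (-1) ^ (m * k) * (-1) ^ k := by ring
    have s3 : (-1 : ℤ) ^ k * (-1) ^ k = 1 := by rw [← mul_pow]; simp
    rw [s1, s2]
    simp only [pow_succ, smul_add, smul_sub, smul_smul, mul_assoc]
    rw [← mul_assoc ((-1 : ℤ) ^ k) ((-1) ^ k) (-1), s3]
    simp only [mul_neg, mul_one, neg_smul]
    abel

end insertInto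

end NijenhuisRichardson

/-! ### Functions of two lists -/

section BiLists

variable {V N : Type*} [AddCommGroup N]

theorem neg_one_pow_add_two_mul (a b : ℕ) : (-1 : ℤ) ^ (a + 2 * b) = (-1) ^ a := by
  simp [pow_add, pow_mul]

/-- The function `f` with its first left argument fixed to be `x`. -/
def contractLeft (x : V) (f : List V → List V → N) : List V → List V → N := fun L M => f (x :: L) M

/-- The function `f` with its first right argument fixed to be `y`, with the sign of moving `y` in
front of the left arguments. -/
def contractRight (y : V) (f : List V → List V → N) : List V → List V → N :=
  fun L M => (-1 : ℤ) ^ L.length • f L (y :: M)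

/-- Multiplication by the parity of the total number of arguments. -/
def bigrade (f : List V → List V → N) : List V → List V → N :=
  fun L M => (-1 : ℤ) ^ (L.length + M.length) • f L M

/-- The function of lists of pairs which is obtained from `f` by using the first components of some
of the pairs as left arguments and the second components of the other pairs as right arguments. -/
def hat (f : List V → List V → N) : List (V × V) → N :=
  unshuffle fun a b => f (a.map Prod.fst) (b.map Prod.snd)

/-- The function of one list obtained from `f` by using some of the vectors as left arguments and
the others as right arguments. -/
def total (f : List V → List V → N) : List V → N := unshuffle f

theorem hat_add (f f' : List V → List V → N) : hat (f + f') = hat f + hat f' :=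
  funext fun l => unshuffle_add _ _ l

theorem hat_neg (f : List V → List V → N) : hat (-f) = - hat f :=
  funext fun l => unshuffle_neg _ l

theorem hat_bigrade (f : List V → List V → N) : hat (bigrade f) = grade (hat f) := by
  funext l
  rw [grade, hat, hat, ← unshuffle_zsmul]
  exact unshuffle_congr l fun a b hab => by rw [bigrade, List.length_map, List.length_map, hab]

theorem contract_hat (w : V × V) (f : List V → List V → N) :
    contract w (hat f) = hat (contractLeft w.1 f + contractRight w.2 f) := by
  funext l
  rw [hat_add]
  simp only [contract, hat, unshuffle_cons, contractLeft, contractRight, Pi.add_apply,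
    List.map_cons, List.length_map]

/-- The function `total f` is the restriction of `hat f` to the diagonal. -/
theorem total_eq_hat (f : List V → List V → N) (l : List V) :
    total f l = hat f (l.map fun x => (x, x)) := by
  simp [hat, unshuffle_list_map, total, Function.comp_def]

variable [AddCommGroup V]

/-- A function of two lists of vectors which is alternating in each of them. -/
structure IsBialternating (f : List V → List V → N) : Prop where
  left : ∀ M, IsAlternating fun L => f L M
  right : ∀ L, IsAlternating (f L)

namespace IsBialternating

variable {f f' : List V → List V → N}

protected theorem add (hf : IsBialternating f) (hf' : IsBialternating f') :
    IsBialternating (f + f') :=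
  ⟨fun M => (hf.left M).add (hf'.left M), fun L => (hf.right L).add (hf'.right L)⟩

protected theorem contractLeft (hf : IsBialternating f) (x : V) :
    IsBialternating (contractLeft x f) :=
  ⟨fun M => (hf.left M).contract x, fun L => hf.right (x :: L)⟩

protected theorem contractRight (hf : IsBialternating f) (x : V) :
    IsBialternating (contractRight x f) :=
  ⟨fun M => (hf.left (x :: M)).grade, fun L => ((hf.right L).contract x).zsmul _⟩

end IsBialternating

theorem IsBialternating.hat {f : List V → List V → N} (hf : IsBialternating f) :
    IsAlternating (hat f) where
  map_add l x y l' := by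
    induction l generalizing f with
    | nil =>
      have e : ∀ u, PostLie.hat f (u :: l') = PostLie.contract u (PostLie.hat f) l' := fun _ => rfl
      rw [List.nil_append, List.nil_append, List.nil_append, e, e, e, contract_hat, contract_hat,
        contract_hat, ← Pi.add_apply (PostLie.hat _) (PostLie.hat _), ← hat_add]
      refine congrArg (fun u => PostLie.hat u l') ?_
      funext L M
      simp only [Pi.add_apply, PostLie.contractLeft, PostLie.contractRight, Prod.fst_add,
        Prod.snd_add, (hf.right L).map_add_head, smul_add]
      rw [(hf.left M).map_add_head]
      abel
    | cons z l ih =>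
      have e : ∀ u, PostLie.hat f (z :: u) = _ := fun u => congrFun (contract_hat z f) u
      simp only [List.cons_append, e, ih ((hf.contractLeft _).add (hf.contractRight _))]
  map_swap l x y l' := by
    induction l generalizing f with
    | nil =>
      have e : ∀ u v, PostLie.hat f (u :: v :: l') =
        PostLie.contract v (PostLie.contract u (PostLie.hat f)) l' := fun _ _ => rfl
      rw [List.nil_append, List.nil_append, e, e, contract_hat, contract_hat,
        contract_hat, contract_hat, ← Pi.neg_apply, ← hat_neg]
      refine congrArg (fun u => PostLie.hat u l') ?_
      funext L M
      simp only [Pi.add_apply, Pi.neg_apply, PostLie.contractLeft, PostLie.contractRight,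
        smul_add, smul_smul, List.length_cons]
      have h1 := (hf.left M).map_swap_head x.1 y.1 L
      have h2 := (hf.right L).map_swap_head x.2 y.2 M
      rw [h1, h2]
      simp only [pow_succ, smul_neg, mul_neg, mul_one, neg_smul]
      abel
    | cons z l ih =>
      have e : ∀ u, PostLie.hat f (z :: u) = _ := fun u => congrFun (contract_hat z f) u
      simp only [List.cons_append, e]
      rw [ih ((hf.contractLeft _).add (hf.contractRight _))]

theorem IsBialternating.total {f : List V → List V → N} (hf : IsBialternating f) :
    IsAlternating (total f) where
  map_add l x y l' := by
    simp only [total_eq_hat, List.map_append, List.map_cons]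
    exact hf.hat.map_add _ (x, x) (y, y) _
  map_swap l x y l' := by
    simp only [total_eq_hat, List.map_append, List.map_cons]
    exact hf.hat.map_swap _ (x, x) (y, y) _

/-- The insertion of `s`, which takes left arguments to a left argument, in `f`. -/
def insertLeftArg (f : List V → List V → N) (s : List V → V) : List V → List V → N :=
  fun L M => insertInto (fun L => f L M) s L

/-- The insertion of `g`, which takes left and right arguments to a right argument, in `f`. The sign
is that of moving `g`, whose degree is one less than the number of its arguments, behind the
arguments `L₁`. -/
def insertRightArg (f g : List V → List V → V) : List V → List V → V :=
  fun L M => unshuffle (fun L₁ L₂ => unshuffle (fun M₁ M₂ =>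
    (-1 : ℤ) ^ (L₁.length * (L₂.length + M₁.length + 1)) • f L₁ (g L₂ M₁ :: M₂)) M) L

section products

variable {f : List V → List V → V} {s : List V → V} {g : List V → List V → V}

theorem contractLeft_insertLeftArg (hf : IsBialternating f) (x : V) :
    contractLeft x (insertLeftArg f s) =
      insertLeftArg f (contract x s) - insertLeftArg (contractLeft x f) (grade s) := by
  funext L M
  exact congrFun (contract_insertInto (hf.left M) x) L

/-- There is no term with a contraction of `s`, which has no right arguments. -/
theorem contractRight_insertLeftArg (hf : IsBialternating f) (y : V) :
    contractRight y (insertLeftArg f s) = - insertLeftArg (contractRight y f) (grade s) := by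
  funext L M
  simp only [contractRight, insertLeftArg, insertInto, Pi.neg_apply, grade]
  rw [← unshuffle_zsmul, ← unshuffle_neg]
  refine unshuffle_congr L fun a b hab => ?_
  have := (hf.left (y :: M)).map_zsmul_head ((-1) ^ a.length) (s a) b
  rw [this, smul_smul, ← neg_smul, ← hab, List.length_cons]
  congr 1
  ring

theorem contractLeft_insertRightArg (hf : IsBialternating f) (x : V) :
    contractLeft x (insertRightArg f g) =
      insertRightArg f (contractLeft x g) - insertRightArg (contractLeft x f) (bigrade g) := by
  funext L M
  simp only [contractLeft, insertRightArg, Pi.sub_apply, unshuffle_cons, bigrade]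
  rw [add_comm, sub_eq_add_neg, ← unshuffle_neg]
  congr 1
  · refine unshuffle_congr L fun a b _ => ?_
    rw [← unshuffle_zsmul]
    refine unshuffle_congr M fun c d _ => ?_
    rw [smul_smul, ← pow_add, List.length_cons]
    congr 1
    rw [← neg_one_pow_add_two_mul (_ * (_ + _ + 1)) a.length]
    congr 1
    ring
  · refine unshuffle_congr L fun a b _ => ?_
    rw [← unshuffle_neg]
    refine unshuffle_congr M fun c d _ => ?_
    rw [(hf.right _).map_zsmul_head, smul_smul, ← neg_smul, List.length_cons]
    congr 1
    ring

theorem contractRight_insertRightArg (hf : IsBialternating f) (y : V) :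
    contractRight y (insertRightArg f g) =
      insertRightArg f (contractRight y g) - insertRightArg (contractRight y f) (bigrade g) := by
  funext L M
  simp only [contractRight, insertRightArg, Pi.sub_apply, unshuffle_cons, bigrade, unshuffle_add,
    smul_add]
  rw [sub_eq_add_neg, ← unshuffle_neg, ← unshuffle_zsmul, ← unshuffle_zsmul]
  congr 1
  · refine unshuffle_congr L fun a b hab => ?_
    rw [← unshuffle_zsmul]
    refine unshuffle_congr M fun c d _ => ?_
    rw [(hf.right _).map_zsmul_head, smul_smul, smul_smul, ← pow_add, ← pow_add, List.length_cons,
      ← hab]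
    congr 1
    rw [← neg_one_pow_add_two_mul (_ * _ + _) a.length]
    congr 1
    ring
  · refine unshuffle_congr L fun a b hab => ?_
    rw [← unshuffle_neg, ← unshuffle_zsmul]
    refine unshuffle_congr M fun c d _ => ?_
    rw [(hf.right _).map_swap_head y, (hf.right _).map_zsmul_head]
    simp only [smul_smul, ← neg_smul]
    congr 1
    rw [← hab]
    ring

/-- The second component of a Nijenhuis–Richardson product on `V × V`, in terms of functions of two
lists. The inserted function has a first component `s` which depends on first components only, and
the second component `hat g`. Both sides have the same contractions, by induction. -/
theorem hat_insert (hf : IsBialternating f) :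
    hat (insertLeftArg f s + insertRightArg f g) =
      insertInto (hat f) fun w => (s (w.map Prod.fst), hat g w) := by
  funext l
  induction l generalizing f s g with
  | nil => simp [hat, insertLeftArg, insertRightArg, insertInto, unshuffle_cons]
  | cons w l ih =>
    have hf' := (hf.contractLeft w.1).add (hf.contractRight w.2)
    have e1 : insertInto (hat f) (contract w fun w => (s (w.map Prod.fst), hat g w)) l =
        insertInto (hat f) (fun u => (contract w.1 s (u.map Prod.fst),
          hat (contractLeft w.1 g + contractRight w.2 g) u)) l := by
      rw [← contract_hat]; rfl
    have e2 : (grade fun w => (s (w.map Prod.fst), hat g w)) =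
        fun u => (grade s (u.map Prod.fst), hat (bigrade g) u) := by
      rw [hat_bigrade]; funext u; simp [grade]
    change contract w (hat _) l = contract w (insertInto _ _) l
    rw [contract_insertInto hf.hat, Pi.sub_apply, e1, e2, contract_hat w f, ← ih hf,
      ← ih hf', contract_hat, ← Pi.sub_apply]
    refine congrFun ?_ l
    rw [sub_eq_add_neg, ← hat_neg, ← hat_add]
    refine congrArg hat ?_
    have a1 : ∀ u v : List V → List V → V, contractLeft w.1 (u + v) =
      contractLeft w.1 u + contractLeft w.1 v := fun _ _ => rfl
    have a2 : ∀ u v : List V → List V → V, contractRight w.2 (u + v) =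
      contractRight w.2 u + contractRight w.2 v := fun _ _ => by
        funext L M; simp [contractRight]
    have a3 : ∀ u v : List V → List V → V, ∀ t, insertLeftArg (u + v) t =
      insertLeftArg u t + insertLeftArg v t := fun _ _ _ => by
        funext L M; exact unshuffle_add _ _ L
    have a4 : ∀ u v t : List V → List V → V, insertRightArg (u + v) t =
      insertRightArg u t + insertRightArg v t := fun _ _ _ => by
        funext L M; simp only [insertRightArg, Pi.add_apply, smul_add, unshuffle_add]
    have a5 : ∀ u v : List V → List V → V, insertRightArg f (u + v) =
      insertRightArg f u + insertRightArg f v := fun _ _ => by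
        funext L M
        simp only [insertRightArg, Pi.add_apply, (hf.right _).map_add_head, smul_add, unshuffle_add]
    rw [a1, a2, contractLeft_insertLeftArg hf, contractRight_insertLeftArg hf,
      contractLeft_insertRightArg hf, contractRight_insertRightArg hf, a3, a4, a5]
    abel

/-- The function with values in `V × V` attached to a function of two lists. Its second component
is `hat f`, and its first component depends on the first components of the arguments only; on the
diagonal of `V × V` both components agree. -/
def double (f : List V → List V → V) : List (V × V) → V × V :=
  fun w => (total f (w.map Prod.fst), hat f w)

/-- `double` takes the composition of functions of two lists to the Nijenhuis–Richardson product
for the space `V × V`. -/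
theorem double_insert (hf : IsBialternating f) :
    double (insertLeftArg f (total g) + insertRightArg f g) =
      insertInto (double f) (double g) := by
  have key := hat_insert (s := total g) (g := g) hf
  funext w
  refine Prod.ext ?_ ?_
  · have e : (insertInto (double f) (double g) w).1 =
        insertInto (total f) (total g) (w.map Prod.fst) := by
      rw [insertInto, insertInto, unshuffle_list_map]
      exact map_unshuffle (AddMonoidHom.fst V V) _ _
    rw [e]
    show total _ _ = _
    -- On the diagonal of `V × V`, `double f` and `double g` have values in the diagonal.
    rw [total_eq_hat, key, insertInto, unshuffle_list_map]
    refine unshuffle_congr _ fun a b _ => ?_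
    rw [total_eq_hat f, total_eq_hat g, List.map_cons, List.map_map]
    simp [Function.comp_def, total_eq_hat]
  · show hat _ w = _
    rw [key]
    exact (map_unshuffle (AddMonoidHom.snd V V) (fun a b => double f (double g a :: b)) w).symm

theorem IsBialternating.double (hf : IsBialternating f) : IsAlternating (double f) where
  map_add l x y l' := by
    simp only [PostLie.double, hf.hat.map_add, List.map_append, List.map_cons, Prod.fst_add,
      hf.total.map_add, Prod.mk_add_mk]
  map_swap l x y l' := by
    simp only [PostLie.double, List.map_append, List.map_cons]
    rw [hf.hat.map_swap, hf.total.map_swap, Prod.neg_mk]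

/-- At arguments from `0 × V` only the splitting survives in which all of them are right
arguments. -/
theorem hat_map_right (hf : IsBialternating f) (M : List V) :
    hat f (M.map fun y => (0, y)) = f [] M := by
  induction M generalizing f with
  | nil => rfl
  | cons y M ih =>
    have e : contractLeft 0 f = 0 := by
      funext L M; exact (hf.left M).map_zero_head L
    rw [List.map_cons]
    change contract (0, y) (hat f) _ = _
    rw [contract_hat, e, zero_add, ih (hf.contractRight y)]
    simp [contractRight]

/-- The function `f` can be recovered from `double f`. -/
theorem snd_double_append (hf : IsBialternating f) (L M : List V) :
    (double f (L.map (fun x => (x, 0)) ++ M.map fun y => (0, y))).2 = f L M := by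
  change hat f _ = _
  induction L generalizing f with
  | nil => exact hat_map_right hf M
  | cons x L ih =>
    have e : contractRight 0 f = 0 := by
      funext L M; simp [contractRight, (hf.right L).map_zero_head]
    rw [List.map_cons, List.cons_append]
    change contract (x, 0) (hat f) _ = _
    rw [contract_hat, e, add_zero, ih (hf.contractLeft x)]
    rfl

end products

end BiLists

/-! ### Sums over shuffle permutations -/

section ShufflePermutations

variable {X N : Type*} [AddCommGroup N]

/-- The permutation `σ` with `σ a = 0` which is given by `τ` on the other positions. -/
def permAt {k : ℕ} (a : Fin (k + 1)) (τ : Equiv.Perm (Fin k)) : Equiv.Perm (Fin (k + 1)) :=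
  Equiv.Perm.decomposeFin.symm (0, τ) * a.cycleRange

@[simp]
theorem permAt_self {k : ℕ} (a : Fin (k + 1)) (τ : Equiv.Perm (Fin k)) : permAt a τ a = 0 := by
  simp [permAt]

@[simp]
theorem permAt_succAbove {k : ℕ} (a : Fin (k + 1)) (τ : Equiv.Perm (Fin k)) (i : Fin k) :
    permAt a τ (a.succAbove i) = (τ i).succ := by
  simp [permAt, Fin.cycleRange_succAbove]

theorem sign_permAt {k : ℕ} (a : Fin (k + 1)) (τ : Equiv.Perm (Fin k)) :
    Equiv.Perm.sign (permAt a τ) = (-1) ^ (a : ℕ) * Equiv.Perm.sign τ := by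
  simp [permAt, Equiv.Perm.decomposeFin.symm_sign, Fin.sign_cycleRange, mul_comm]

theorem permAt_bijective (k : ℕ) :
    Function.Bijective fun u : Fin (k + 1) × Equiv.Perm (Fin k) => permAt u.1 u.2 := by
  rw [Fintype.bijective_iff_injective_and_card]
  constructor
  · rintro ⟨a, τ⟩ ⟨b, τ'⟩ h
    simp only at h
    have hab : a = b := by
      apply (permAt a τ).injective
      rw [permAt_self, h, permAt_self]
    subst hab
    have := Equiv.Perm.decomposeFin.symm.injective (mul_right_cancel h)
    simpa using this
  · simp [Fintype.card_perm, Nat.factorial_succ]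

theorem isShuffle_permAt {k : ℕ} (c : Fin (k + 1) → ℕ) (a : Fin (k + 1)) (τ : Equiv.Perm (Fin k)) :
    IsShuffle c (permAt a τ) ↔
      (∀ b, b < a → c b ≠ c a) ∧ IsShuffle (fun i => c (a.succAbove i)) τ := by
  constructor
  · intro h
    refine ⟨fun b hb hc => ?_, fun i j hij hc => ?_⟩
    · simpa using h b a hb hc
    · simpa using h _ _ (Fin.strictMono_succAbove a hij) hc
  · rintro ⟨h1, h2⟩ b b' hb hc
    rcases Fin.eq_self_or_eq_succAbove a b with rfl | ⟨i, rfl⟩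
    · rcases Fin.eq_self_or_eq_succAbove b b' with rfl | ⟨j, rfl⟩
      · exact absurd hb (lt_irrefl _)
      · simp
    · rcases Fin.eq_self_or_eq_succAbove a b' with rfl | ⟨j, rfl⟩
      · exact absurd hc (h1 _ hb)
      · simpa using h2 i j ((Fin.strictMono_succAbove a).lt_iff_lt.1 hb) hc

open Classical in
/-- The recursion for signed sums over shuffles: the position `a` with `σ a = 0` is the first one of
its block. -/
theorem sum_isShuffle_succ {k : ℕ} (c : Fin (k + 1) → ℕ) (G : (Fin (k + 1) → X) → N)
    (x : Fin (k + 1) → X) :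
    ∑ σ ∈ Finset.univ.filter (IsShuffle c), Equiv.Perm.sign σ • G (fun a => x (σ a)) =
      ∑ a, if (∀ b, b < a → c b ≠ c a) then (-1 : ℤ) ^ (a : ℕ) •
        ∑ τ ∈ Finset.univ.filter (IsShuffle fun i => c (a.succAbove i)),
          Equiv.Perm.sign τ • G (a.insertNth (x 0) fun i => x (τ i).succ) else 0 := by
  rw [Finset.sum_filter, ← (permAt_bijective k).sum_comp, Fintype.sum_prod_type]
  refine Finset.sum_congr rfl fun a _ => ?_
  split_ifs with ha
  · rw [Finset.sum_filter, Finset.smul_sum]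
    refine Finset.sum_congr rfl fun τ _ => ?_
    have hiff := (isShuffle_permAt c a τ).trans (and_iff_right ha)
    by_cases hτ : IsShuffle c (permAt a τ)
    · rw [if_pos hτ, if_pos (hiff.1 hτ), sign_permAt, mul_smul]
      have : (fun b => x (permAt a τ b)) = a.insertNth (x 0) fun i => x (τ i).succ := by
        rw [Fin.eq_insertNth_iff]
        simp [Fin.removeNth, funext_iff]
      rw [this]
      simp [Units.smul_def]
    · rw [if_neg hτ, if_neg fun e => hτ (hiff.2 e), smul_zero]
  · refine Finset.sum_eq_zero fun τ _ => if_neg ?_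
    rw [isShuffle_permAt]
    exact fun h => ha h.1

theorem sum_fin_ite_val_eq {n : ℕ} (p : ℕ) (T : Fin n → N) :
    (∑ a : Fin n, if (a : ℕ) = p then T a else 0) = if h : p < n then T ⟨p, h⟩ else 0 := by
  split_ifs with h
  · rw [Finset.sum_eq_single ⟨p, h⟩]
    · simp
    · intro b _ hb
      exact if_neg fun e => hb (Fin.ext e)
    · simp
  · exact Finset.sum_eq_zero fun a _ => if_neg (by omega)

theorem val_succAbove {k : ℕ} (a : Fin (k + 1)) (i : Fin k) :
    ((a.succAbove i : Fin (k + 1)) : ℕ) = if (i : ℕ) < a then (i : ℕ) else i + 1 := by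
  rw [Fin.succAbove]
  simp only [Fin.lt_def, Fin.val_castSucc]
  split_ifs <;> simp

/-- The positions that come first in their block, for three consecutive blocks, are the starting
points of the nonempty blocks. -/
theorem first_block₃ {k p q : ℕ} (a : Fin (k + 1)) :
    (∀ b : Fin (k + 1), b < a → block₃ p q b ≠ block₃ p q a) ↔
      ((a : ℕ) = 0 ∧ p ≠ 0) ∨ ((a : ℕ) = p ∧ q ≠ 0) ∨ (a : ℕ) = p + q := by
  have ha := a.isLt
  constructor
  · intro H
    by_contra hc
    have key : ∀ b : ℕ, b < a → (if b < p then 0 else if b < p + q then 1 else 2) ≠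
        block₃ p q a := fun b hb => H ⟨b, by omega⟩ hb
    have h0 := key 0
    have h1 := key p
    have h2 := key (p + q)
    simp only [block₃] at h0 h1 h2
    split_ifs at h0 h1 h2 <;> omega
  · intro H b hb
    rw [Fin.lt_def] at hb
    simp only [block₃]
    split_ifs <;> omega

theorem ofFn_insertNth {k : ℕ} (a : Fin (k + 1)) (y : X) (u : Fin k → X) :
    List.ofFn (a.insertNth y u : Fin (k + 1) → X) =
      (List.ofFn u).take a ++ y :: (List.ofFn u).drop a := by
  have ha := a.isLt
  apply List.ext_getElem
  · simp; omega
  · intro n h1 h2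
    simp only [List.length_ofFn] at h1
    rw [List.getElem_ofFn]
    rcases lt_trichotomy n a with hn | hn | hn
    · rw [List.getElem_append_left (by simp; omega), List.getElem_take, List.getElem_ofFn]
      have : (⟨n, h1⟩ : Fin (k + 1)) = a.succAbove ⟨n, by omega⟩ := by
        apply Fin.ext; rw [val_succAbove]; simp [hn]
      rw [this, Fin.insertNth_apply_succAbove]
    · subst hn
      rw [List.getElem_append_right (by simp)]
      simp [Nat.min_eq_left (by omega : (a : ℕ) ≤ k)]
    · rw [List.getElem_append_right (by simp; omega)]
      have : (⟨n, h1⟩ : Fin (k + 1)) = a.succAbove ⟨n - 1, by omega⟩ := by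
        apply Fin.ext; rw [val_succAbove]; simp; split_ifs <;> omega
      rw [this, Fin.insertNth_apply_succAbove]
      obtain ⟨d, rfl⟩ : ∃ d, n = a + d + 1 := ⟨n - a - 1, by omega⟩
      have e : (a : ℕ) + d + 1 - min (a : ℕ) k = d + 1 := by omega
      simp [e]

open Classical in
/-- The sum over the `(p, q, k - p - q)`-shuffles is the part of the sum over all splittings of the
list of arguments in which the first two parts have lengths `p` and `q`. -/
theorem sum_shuffles₃ {k : ℕ} (p q : ℕ) (h : p + q ≤ k) (φ : List X → List X → List X → N)
    (x : Fin k → X) :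
    ∑ σ ∈ shuffles₃ p q k, Equiv.Perm.sign σ •
      φ ((List.ofFn fun a => x (σ a)).take p) (((List.ofFn fun a => x (σ a)).drop p).take q)
        ((List.ofFn fun a => x (σ a)).drop (p + q)) =
      unshuffle₃ (fun a b c => if a.length = p ∧ b.length = q then φ a b c else 0)
        (List.ofFn x) := by
  induction k generalizing p q φ with
  | zero =>
    obtain ⟨rfl, rfl⟩ : p = 0 ∧ q = 0 := by omega
    have : shuffles₃ 0 0 0 = Finset.univ := by
      rw [shuffles₃, Finset.filter_true_of_mem]
      intro σ _ a
      exact a.elim0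
    simp [this, unshuffle₃]
  | succ k ih =>
    have hrec := sum_isShuffle_succ (block₃ p q) (fun v => φ ((List.ofFn v).take p)
      (((List.ofFn v).drop p).take q) ((List.ofFn v).drop (p + q))) x
    rw [shuffles₃, hrec]
    -- `T a` is the part of the sum with `σ a = 0`; it is nonzero at most for `a = 0, p, p + q`.
    set T : Fin (k + 1) → N := fun a => (-1 : ℤ) ^ (a : ℕ) •
      ∑ τ ∈ Finset.univ.filter (IsShuffle fun i => block₃ p q (a.succAbove i)),
        Equiv.Perm.sign τ • (fun v : Fin (k + 1) → X => φ ((List.ofFn v).take p)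
          (((List.ofFn v).drop p).take q) ((List.ofFn v).drop (p + q)))
          (a.insertNth (x 0) fun i => x (τ i).succ) with hT
    have hsplit : ∀ a : Fin (k + 1),
        (if (∀ b, b < a → block₃ p q b ≠ block₃ p q a) then T a else 0) =
        (if (a : ℕ) = 0 then (if p ≠ 0 then T a else 0) else 0) +
        (if (a : ℕ) = p then (if q ≠ 0 then T a else 0) else 0) +
        (if (a : ℕ) = p + q then T a else 0) := by
      intro a
      simp only [first_block₃ a]
      split_ifs <;> first | omega | simp
    rw [Finset.sum_congr rfl fun a _ => hsplit a, Finset.sum_add_distrib, Finset.sum_add_distrib,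
      sum_fin_ite_val_eq, sum_fin_ite_val_eq, sum_fin_ite_val_eq, List.ofFn_succ, unshuffle₃_cons]
    congr 1
    · congr 1
      · rw [dif_pos (Nat.succ_pos k)]
        obtain _ | p := p
        · simp
        · rw [if_pos (Nat.succ_ne_zero p)]
          simp only [List.length_cons, Nat.add_right_cancel_iff]
          rw [← ih p q (by omega) (fun a b c => φ (x 0 :: a) b c), hT]
          have hb : (fun i : Fin k => block₃ (p + 1) q (Fin.succAbove ⟨0, Nat.succ_pos k⟩ i)) =
              block₃ p q := by
            funext i
            simp only [block₃, val_succAbove]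
            split_ifs <;> omega
          simp only [hb, ofFn_insertNth, shuffles₃, pow_zero, one_smul, List.take_zero,
            List.drop_zero, List.nil_append, List.take_succ_cons, List.drop_succ_cons,
            Nat.add_right_comm p 1 q]
      · by_cases hp : p < k + 1
        swap
        · rw [dif_neg hp]
          symm
          obtain rfl : q = 0 := by omega
          simp
        rw [dif_pos hp]
        obtain _ | q := q
        · simp
        · rw [if_pos (Nat.succ_ne_zero q)]
          have := ih p q (by omega) (fun a b c => (-1 : ℤ) ^ a.length • φ a (x 0 :: b) c)
            (fun i => x i.succ)
          simp only [List.length_cons, Nat.add_right_cancel_iff, smul_ite, smul_zero]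
          rw [← this, hT]
          have hb : (fun i : Fin k => block₃ p (q + 1) (Fin.succAbove ⟨p, hp⟩ i)) =
              block₃ p q := by
            funext i
            simp only [block₃, val_succAbove]
            split_ifs <;> omega
          simp only [hb, ofFn_insertNth, shuffles₃, Finset.smul_sum]
          refine Finset.sum_congr rfl fun τ _ => ?_
          have hl : (List.take p (List.ofFn fun i => x (τ i).succ)).length = p := by
            simp; omega
          rw [smul_comm, hl, List.take_left' hl, ← List.drop_drop, List.drop_left' hl,
            List.take_succ_cons, List.drop_succ_cons, List.drop_drop]
    · by_cases hp : p + q < k + 1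
      swap
      · rw [dif_neg hp]
        symm
        refine (unshuffle₃_congr (G' := fun _ _ _ => 0) _ fun a b c habc => ?_).trans
          (unshuffle₃_zero _)
        rw [List.length_ofFn] at habc
        rw [if_neg (by omega), smul_zero]
      rw [dif_pos hp]
      have := ih p q (by omega) (fun a b c => (-1 : ℤ) ^ (a.length + b.length) • φ a b (x 0 :: c))
        (fun i => x i.succ)
      simp only [smul_ite, smul_zero]
      rw [← this, hT]
      have hb : (fun i : Fin k => block₃ p q (Fin.succAbove ⟨p + q, hp⟩ i)) = block₃ p q := by
        funext i
        simp only [block₃, val_succAbove]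
        split_ifs <;> omega
      simp only [hb, ofFn_insertNth, shuffles₃, Finset.smul_sum]
      refine Finset.sum_congr rfl fun τ _ => ?_
      have hl : (List.take (p + q) (List.ofFn fun i => x (τ i).succ)).length = p + q := by
        simp; omega
      rw [smul_comm, List.drop_left' hl]
      set l := List.ofFn fun i => x (τ i).succ
      have hl' : l.length = k := by simp [l]
      have e1 : (List.take (p + q) l ++ x 0 :: List.drop (p + q) l).take p = l.take p := by
        rw [List.take_append_of_le_length (by omega), List.take_take]; simp
      have e2 : ((List.take (p + q) l ++ x 0 :: List.drop (p + q) l).drop p).take q =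
          (l.drop p).take q := by
        rw [List.drop_append_of_le_length (by omega),
          List.take_append_of_le_length (by simp [hl']; omega), List.drop_take]
        simp
      rw [e1, e2, List.length_take, List.length_take, List.length_drop, hl',
        Nat.min_eq_left (by omega), Nat.min_eq_left (by omega)]

/-- The sum over the `(p, k - p)`-shuffles is the part of the sum over all splittings of the list of
arguments in which the first part has length `p`. -/
theorem sum_shuffles₂ {k : ℕ} (p : ℕ) (h : p ≤ k) (φ : List X → List X → N) (x : Fin k → X) :
    ∑ σ ∈ shuffles₂ p k, Equiv.Perm.sign σ •
      φ ((List.ofFn fun a => x (σ a)).take p) ((List.ofFn fun a => x (σ a)).drop p) =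
      unshuffle (fun a b => if a.length = p then φ a b else 0) (List.ofFn x) := by
  have e : shuffles₂ p k = shuffles₃ p (k - p) k := by
    have hb : (block₂ p : Fin k → ℕ) = block₃ p (k - p) := by
      funext a
      have := a.isLt
      simp only [block₂, block₃]
      split_ifs <;> omega
    rw [shuffles₂, shuffles₃, hb]
  rw [e, ← unshuffle₃_ite_nil]
  have := sum_shuffles₃ p (k - p) (by omega) (fun a b _ => φ a b) x
  rw [unshuffle₃_congr (G' := fun a b c => if a.length = p ∧ b.length = k - p then φ a b else 0),
    ← this]
  · refine Finset.sum_congr rfl fun σ _ => ?_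
    congr 2
    rw [List.take_of_length_le (by simp)]
  · intro a b c habc
    rw [List.length_ofFn] at habc
    split_ifs <;> first | omega | rfl

theorem take_ofFn {k : ℕ} (p : ℕ) (h : p ≤ k) (v : Fin k → X) :
    (List.ofFn v).take p = List.ofFn fun a : Fin p => v ⟨a, by omega⟩ := by
  apply List.ext_getElem <;> simp [h]

theorem drop_ofFn {k : ℕ} (p q : ℕ) (h : p + q = k) (v : Fin k → X) :
    (List.ofFn v).drop p = List.ofFn fun a : Fin q => v ⟨p + a, by omega⟩ := by
  apply List.ext_getElem <;> simp; omega

end ShufflePermutations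

/-! ### Cochains as functions of two lists -/

section OnLists

variable {K V N : Type*} [CommRing K] [AddCommGroup V] [Module K V] [AddCommGroup N] [Module K N]

/-- Evaluation of an alternating map in `p` arguments at a list; the value is `0` if the length of
the list is not `p`. -/
def evalList {p : ℕ} (l : List V) : (V [⋀^Fin p]→ₗ[K] N) →ₗ[K] N where
  toFun φ := if l.length = p then φ fun a => l.getD a 0 else 0
  map_add' φ ψ := by split_ifs <;> simp
  map_smul' c φ := by split_ifs <;> simp

theorem evalList_apply {p : ℕ} (l : List V) (φ : V [⋀^Fin p]→ₗ[K] N) :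
    evalList l φ = if l.length = p then φ fun a => l.getD a 0 else 0 := rfl

theorem evalList_of_length_ne {p : ℕ} {l : List V} (h : l.length ≠ p) (φ : V [⋀^Fin p]→ₗ[K] N) :
    evalList l φ = 0 := if_neg h

theorem evalList_ofFn {p : ℕ} (v : Fin p → V) (φ : V [⋀^Fin p]→ₗ[K] N) :
    evalList (List.ofFn v) φ = φ v := by
  rw [evalList_apply, if_pos (by simp)]
  congr 1
  funext a
  simp [List.getD_eq_getElem?_getD]

theorem isAlternating_evalList {p : ℕ} (φ : V [⋀^Fin p]→ₗ[K] N) :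
    IsAlternating fun l => evalList l φ where
  map_add l x y l' := by
    simp only [evalList_apply, List.length_append, List.length_cons]
    split_ifs with h
    · have hl : l.length < p := by omega
      -- As a function of the entry at `l.length`, the argument vector is an update of a fixed one.
      have key : ∀ z : V, (fun a : Fin p => (l ++ z :: l').getD a 0) =
          Function.update (fun a : Fin p => (l ++ 0 :: l').getD a 0) ⟨l.length, hl⟩ z := by
        intro z
        funext a
        by_cases ha : a = ⟨l.length, hl⟩
        · subst ha; simp
        · rw [Function.update_of_ne ha]
          have ha' : (a : ℕ) ≠ l.length := fun e => ha (Fin.ext e)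
          simp only [List.getD_eq_getElem?_getD]
          congr 1
          rcases lt_or_gt_of_ne ha' with h1 | h1
          · rw [List.getElem?_append_left h1, List.getElem?_append_left h1]
          · rw [List.getElem?_append_right h1.le, List.getElem?_append_right h1.le]
            obtain ⟨d, hd⟩ : ∃ d, (a : ℕ) - l.length = d + 1 := ⟨a - l.length - 1, by omega⟩
            rw [hd]; simp
      rw [key x, key y, key (x + y), φ.map_update_add]
    · simp
  map_swap l x y l' := by
    simp only [evalList_apply, List.length_append, List.length_cons]
    split_ifs with h
    · have hl : l.length < p := by omega
      have hl' : l.length + 1 < p := by omega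
      rw [← φ.map_swap _ (i := ⟨l.length, hl⟩) (j := ⟨l.length + 1, hl'⟩) (by simp)]
      congr 1
      funext a
      simp only [Function.comp_apply, Equiv.swap_apply_def, List.getD_eq_getElem?_getD]
      congr 1
      split_ifs with h1 h2
      · subst h1; simp
      · subst h2; simp
      · have h1' : (a : ℕ) ≠ l.length := fun e => h1 (Fin.ext e)
        have h2' : (a : ℕ) ≠ l.length + 1 := fun e => h2 (Fin.ext e)
        rcases lt_or_gt_of_ne h1' with h3 | h3
        · rw [List.getElem?_append_left h3, List.getElem?_append_left h3]
        · rw [List.getElem?_append_right h3.le, List.getElem?_append_right h3.le]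
          obtain ⟨d, hd⟩ : ∃ d, (a : ℕ) - l.length = d + 2 := ⟨a - l.length - 2, by omega⟩
          rw [hd]; simp
    · simp

theorem IsAlternating.map {N' : Type*} [AddCommGroup N'] {f : List V → N} (hf : IsAlternating f)
    (ψ : N →+ N') : IsAlternating fun l => ψ (f l) where
  map_add l x y l' := by rw [hf.map_add, _root_.map_add]
  map_swap l x y l' := by rw [hf.map_swap, _root_.map_neg]

theorem IsAlternating.sum {ι : Type*} (S : Finset ι) {f : ι → List V → N}
    (hf : ∀ i, IsAlternating (f i)) : IsAlternating fun l => ∑ i ∈ S, f i l where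
  map_add l x y l' := by
    rw [← Finset.sum_add_distrib]
    exact Finset.sum_congr rfl fun i _ => (hf i).map_add l x y l'
  map_swap l x y l' := by
    rw [← Finset.sum_neg_distrib]
    exact Finset.sum_congr rfl fun i _ => (hf i).map_swap l x y l'

variable {n m : ℕ}

/-- A cochain as a function of the list of its left arguments and the list of its right arguments;
the value is `0` if there is no component with these numbers of arguments. -/
def onLists (f : Cochain K V n) (L M : List V) : V :=
  ∑ i : Fin (n + 1), evalList M (evalList L (f i))

theorem isBialternating_onLists (f : Cochain K V n) : IsBialternating (onLists f) where
  left M := IsAlternating.sum _ fun i =>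
    (isAlternating_evalList (f i)).map (evalList M).toAddMonoidHom
  right L := IsAlternating.sum _ fun i => isAlternating_evalList (evalList L (f i))

theorem onLists_ofFn (f : Cochain K V n) {i i' r : ℕ} (hi : i ≤ n) (hii' : i = i')
    (hr : n + 1 - i = r) (u : Fin i' → V) (w : Fin r → V) :
    onLists f (List.ofFn u) (List.ofFn w) =
      f.comp i hi (fun a => u (Fin.cast hii' a)) (fun b => w (Fin.cast hr b)) := by
  subst hii' hr
  rw [onLists, Finset.sum_eq_single ⟨i, Nat.lt_succ_of_le hi⟩]
  · rw [evalList_ofFn (p := i) u]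
    exact evalList_ofFn w _
  · intro b _ hb
    rw [evalList_of_length_ne (l := List.ofFn u), map_zero]
    rw [List.length_ofFn]
    exact fun e => hb (Fin.ext e.symm)
  · simp

theorem onLists_eq_zero (f : Cochain K V n) (L M : List V)
    (h : ¬ (L.length ≤ n ∧ L.length + M.length = n + 1)) : onLists f L M = 0 := by
  refine Finset.sum_eq_zero fun i _ => ?_
  have hi := i.isLt
  by_cases h1 : L.length = i
  · exact evalList_of_length_ne (by omega) _
  · rw [evalList_of_length_ne h1, map_zero]

theorem onLists_injective : Function.Injective (onLists : Cochain K V n → List V → List V → V) := by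
  intro f g h
  funext i
  ext u w
  have e := congrFun (congrFun h (List.ofFn u)) (List.ofFn w)
  rwa [onLists_ofFn f (Nat.le_of_lt_succ i.isLt) rfl rfl,
    onLists_ofFn g (Nat.le_of_lt_succ i.isLt) rfl rfl] at e

theorem onLists_add (f g : Cochain K V n) : onLists (f + g) = onLists f + onLists g := by
  funext L M
  have e : ∀ i, (f + g) i = f i + g i := fun _ => rfl
  simp only [onLists, Pi.add_apply, e, map_add, Finset.sum_add_distrib]

theorem onLists_smul (c : K) (f : Cochain K V n) : onLists (c • f) = c • onLists f := by
  funext L M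
  have e : ∀ i, (c • f) i = c • f i := fun _ => rfl
  simp only [onLists, Pi.smul_apply, e, map_smul, Finset.smul_sum]

section products

variable (f : Cochain K V n) (g : Cochain K V m)

/-- The term `j` of the first sum in `f ∘ g`: the splittings in which `g_j` is applied. -/
theorem insertLeft_eq_unshuffle₃ (k j : ℕ) (hk : k ≤ n + m) (hj : j ≤ m) (hmk : m + 1 ≤ k)
    (x : Fin k → V) (y : Fin (n + m + 1 - k) → V) :
    insertLeft f g k j hk hj hmk x y = unshuffle₃ (fun a b c => if a.length = j ∧
      b.length = m + 1 - j then onLists f (onLists g a b :: c) (List.ofFn y) else 0)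
        (List.ofFn x) := by
  rw [insertLeft_apply, ← sum_shuffles₃ j (m + 1 - j) (by omega)]
  refine Finset.sum_congr rfl fun σ _ => ?_
  congr 1
  have e : ∀ b : ℕ, j + (m + 1 - j) + b = m + 1 + b := fun b => by omega
  rw [take_ofFn j (by omega), drop_ofFn j (k - j) (by omega), take_ofFn (m + 1 - j) (by omega),
    drop_ofFn (j + (m + 1 - j)) (k - m - 1) (by omega),
    onLists_ofFn g hj rfl rfl, ← List.ofFn_cons,
    onLists_ofFn f (by omega : k - m ≤ n) (by omega) (by omega)]
  simp only [e]
  rfl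

theorem insertLeftArg_total_onLists (L M : List V) :
    insertLeftArg (onLists f) (total (onLists g)) L M =
      unshuffle₃ (fun a b c => onLists f (onLists g a b :: c) M) L := by
  rw [← unshuffle_unshuffle]
  exact unshuffle_congr L fun u c _ =>
    map_unshuffle (((isBialternating_onLists f).left M).head c) (onLists g) u

theorem sum_insertLeft (k : ℕ) (hk : k ≤ n + m) (x : Fin k → V) (y : Fin (n + m + 1 - k) → V) :
    (if hmk : m + 1 ≤ k then
      ∑ j : Fin (m + 1), insertLeft f g k j hk (Nat.le_of_lt_succ j.isLt) hmk else 0) x y =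
      insertLeftArg (onLists f) (total (onLists g)) (List.ofFn x) (List.ofFn y) := by
  rw [insertLeftArg_total_onLists]
  split_ifs with hmk
  · simp only [sum_apply', insertLeft_eq_unshuffle₃]
    rw [← unshuffle₃_sum]
    refine unshuffle₃_congr _ fun a b c _ => ?_
    by_cases h : a.length ≤ m ∧ a.length + b.length = m + 1
    · rw [Finset.sum_eq_single ⟨a.length, by omega⟩]
      · exact if_pos ⟨rfl, by simp only; omega⟩
      · intro j _ hj
        exact if_neg fun e => hj (Fin.ext e.1.symm)
      · simp
    · rw [onLists_eq_zero g a b h, ((isBialternating_onLists f).left _).map_zero_head]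
      refine Finset.sum_eq_zero fun j _ => ?_
      split_ifs <;> rfl
  · rw [AlternatingMap.zero_apply, AlternatingMap.zero_apply]
    refine ((unshuffle₃_congr (G' := fun _ _ _ => 0) _ fun a b c habc => ?_).trans
      (unshuffle₃_zero _)).symm
    rw [List.length_ofFn] at habc
    rw [onLists_eq_zero g a b (by omega), ((isBialternating_onLists f).left _).map_zero_head]

/-- The term `j` of the second sum in `f ∘ g`: the splittings in which `f_{k-j}` and `g_j` are
applied. -/
theorem insertRight_eq_unshuffle (k j : ℕ) (hj : j ≤ m) (hjk : j ≤ k) (hkn : k ≤ n + j)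
    (x : Fin k → V) (y : Fin (n + m + 1 - k) → V) :
    insertRight f g k j hj hjk hkn x y = unshuffle (fun a b => if a.length = k - j then
      unshuffle (fun c d => if c.length = m + 1 - j then
        (-1 : ℤ) ^ (a.length * (b.length + c.length + 1)) • onLists f a (onLists g b c :: d) else 0)
        (List.ofFn y) else 0) (List.ofFn x) := by
  rw [insertRight_apply, ← sum_shuffles₂ (k - j) (by omega)]
  refine Finset.sum_congr rfl fun σ _ => ?_
  rw [← sum_shuffles₂ (m + 1 - j) (by omega), Finset.smul_sum]
  refine Finset.sum_congr rfl fun τ _ => ?_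
  congr 2
  rw [take_ofFn (k - j) (by omega), drop_ofFn (k - j) j (by omega),
    take_ofFn (m + 1 - j) (by omega),
    drop_ofFn (m + 1 - j) (n + j - k) (by omega),
    onLists_ofFn g hj rfl rfl, ← List.ofFn_cons,
    onLists_ofFn f (by omega : k - j ≤ n) rfl (by omega)]
  simp only [List.length_ofFn]
  -- The inserted component has `m + 1` arguments in all, and `m + 2` has the parity of `m`.
  have s : (-1 : ℤ) ^ ((k - j) * (j + (m + 1 - j) + 1)) = (-1) ^ (m * (k - j)) := by
    rw [← neg_one_pow_add_two_mul (m * (k - j)) (k - j)]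
    congr 1
    have : j + (m + 1 - j) + 1 = m + 2 := by omega
    rw [this]
    ring
  rw [s]
  rcases neg_one_pow_eq_or ℤ (m * (k - j)) with h | h
  · have h' : (-1 : K) ^ (m * (k - j)) = 1 := by exact_mod_cast congrArg (Int.cast (R := K)) h
    rw [h, h', one_smul, one_smul]
    rfl
  · have h' : (-1 : K) ^ (m * (k - j)) = -1 := by exact_mod_cast congrArg (Int.cast (R := K)) h
    rw [h, h', neg_one_smul, neg_one_smul]
    rfl

theorem sum_insertRight (k : ℕ) (x : Fin k → V) (y : Fin (n + m + 1 - k) → V) :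
    (∑ j : Fin (m + 1), if h : (j : ℕ) ≤ k ∧ k ≤ n + j then
      insertRight f g k j (Nat.le_of_lt_succ j.isLt) h.1 h.2 else 0) x y =
      insertRightArg (onLists f) (onLists g) (List.ofFn x) (List.ofFn y) := by
  have e : ∀ j : Fin (m + 1), (if h : (j : ℕ) ≤ k ∧ k ≤ n + j then
      insertRight f g k j (Nat.le_of_lt_succ j.isLt) h.1 h.2 else 0) x y =
      unshuffle (fun a b => unshuffle (fun c d =>
        if ((j : ℕ) ≤ k ∧ k ≤ n + j) ∧ a.length = k - j ∧ c.length = m + 1 - j then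
        (-1 : ℤ) ^ (a.length * (b.length + c.length + 1)) • onLists f a (onLists g b c :: d) else 0)
        (List.ofFn y)) (List.ofFn x) := by
    intro j
    split_ifs with h
    · rw [insertRight_eq_unshuffle]
      refine unshuffle_congr _ fun a b _ => ?_
      split_ifs with h1 <;> simp [h, h1]
    · simp [h]
  simp only [sum_apply', e]
  rw [insertRightArg, ← unshuffle_sum]
  refine unshuffle_congr _ fun a b hab => ?_
  rw [← unshuffle_sum]
  refine unshuffle_congr _ fun c d _ => ?_
  rw [List.length_ofFn] at hab
  by_cases h : b.length ≤ m ∧ b.length + c.length = m + 1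
  · by_cases ha : a.length ≤ n
    · rw [Finset.sum_eq_single ⟨b.length, by omega⟩]
      · exact if_pos ⟨⟨by simp only; omega, by simp only; omega⟩, by simp only; omega,
          by simp only; omega⟩
      · intro j _ hj
        exact if_neg fun e => hj (Fin.ext (by simp only; omega))
      · simp
    · rw [onLists_eq_zero f a _ (by omega), smul_zero]
      refine Finset.sum_eq_zero fun j _ => ?_
      split_ifs <;> rfl
  · rw [onLists_eq_zero g b c h, ((isBialternating_onLists f).right _).map_zero_head, smul_zero]
    refine Finset.sum_eq_zero fun j _ => ?_
    split_ifs <;> rfl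

/-- The composition of cochains in terms of functions of lists. -/
theorem onLists_circ :
    onLists (circ K V n m f g) =
      insertLeftArg (onLists f) (total (onLists g)) + insertRightArg (onLists f) (onLists g) := by
  funext L M
  by_cases h : L.length ≤ n + m ∧ L.length + M.length = n + m + 1
  · obtain ⟨x, hx⟩ : ∃ x : Fin L.length → V, L = List.ofFn x := ⟨L.get, (List.ofFn_get L).symm⟩
    obtain ⟨y, hy⟩ : ∃ y : Fin (n + m + 1 - L.length) → V, M = List.ofFn y := by
      have : n + m + 1 - L.length = M.length := by omega
      rw [this]
      exact ⟨M.get, (List.ofFn_get M).symm⟩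
    generalize L.length = k at *
    subst hx hy
    rw [onLists_ofFn _ h.1 rfl rfl, Pi.add_apply, Pi.add_apply, ← sum_insertRight,
      ← sum_insertLeft f g k h.1]
    rfl
  · rw [onLists_eq_zero _ _ _ h, Pi.add_apply, Pi.add_apply, insertLeftArg_total_onLists,
      insertRightArg]
    have h1 : unshuffle₃ (fun a b c => onLists f (onLists g a b :: c) M) L = 0 := by
      refine (unshuffle₃_congr (G' := fun _ _ _ => 0) _ fun a b c habc => ?_).trans
        (unshuffle₃_zero _)
      by_cases hab : a.length ≤ m ∧ a.length + b.length = m + 1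
      · refine onLists_eq_zero f _ _ fun hc => h ?_
        rw [List.length_cons] at hc
        omega
      · rw [onLists_eq_zero g a b hab, ((isBialternating_onLists f).left _).map_zero_head]
    rw [h1, zero_add]
    symm
    refine (unshuffle_congr (G' := fun _ _ => 0) _ fun a b hab => ?_).trans (unshuffle_zero _)
    refine (unshuffle_congr (G' := fun _ _ => 0) _ fun c d hcd => ?_).trans (unshuffle_zero _)
    by_cases hbc : b.length ≤ m ∧ b.length + c.length = m + 1
    · rw [onLists_eq_zero f, smul_zero]
      intro hc
      rw [List.length_cons] at hc
      omega
    · rw [onLists_eq_zero g b c hbc, ((isBialternating_onLists f).right _).map_zero_head, smul_zero]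

end products

end OnLists

/-! ### The graded Lie algebra of cochains -/

section GradedLieAlgebra

variable {K V : Type*} [CommRing K] [AddCommGroup V] [Module K V] {n m : ℕ}

theorem hat_onLists_eq_zero (f : Cochain K V n) (w : List (V × V)) (hw : w.length ≠ n + 1) :
    hat (onLists f) w = 0 := by
  refine (unshuffle_congr (G' := fun _ _ => 0) _ fun a b hab => ?_).trans (unshuffle_zero _)
  refine onLists_eq_zero f _ _ fun h => hw ?_
  rw [← hab, ← h.2, List.length_map, List.length_map]

theorem double_onLists_eq_zero (f : Cochain K V n) (w : List (V × V)) (hw : w.length ≠ n + 1) :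
    double (onLists f) w = 0 := by
  refine Prod.ext ?_ (hat_onLists_eq_zero f w hw)
  show total _ _ = _
  rw [total_eq_hat]
  exact hat_onLists_eq_zero f _ (by simpa using hw)

theorem hasParity_double_onLists (f : Cochain K V n) : HasParity n (double (onLists f)) := by
  intro w hw
  refine double_onLists_eq_zero f w fun h => ?_
  rw [h, add_right_comm, Nat.even_add_one] at hw
  exact hw ⟨n, rfl⟩

theorem map_smul_unshuffle {X : Type*} (c : K) (G : List X → List X → V) (l : List X) :
    unshuffle (fun a b => c • G a b) l = c • unshuffle G l :=
  (map_unshuffle (DistribSMul.toAddMonoidHom V c) G l).symm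

variable (K V)

/-- A cochain of degree `n`, as a function of lists of elements of `V × V`. -/
def doubleHom (n : ℕ) : Cochain K V n →ₗ[K] (List (V × V) → V × V) where
  toFun f := double (onLists f)
  map_add' f g := by
    funext w
    rw [onLists_add]
    exact Prod.ext (unshuffle_add _ _ _) (unshuffle_add _ _ _)
  map_smul' c f := by
    funext w
    rw [onLists_smul]
    exact Prod.ext (map_smul_unshuffle _ _ _) (map_smul_unshuffle _ _ _)

/-- The embedding of `C^*_{postLie}(V, V)` in the Nijenhuis–Richardson algebra of `V × V`. -/
noncomputable def embed : (⨁ n, Cochain K V n) →ₗ[K] (List (V × V) → V × V) :=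
  DirectSum.toModule K ℕ _ (doubleHom K V)

variable {K V}

@[simp]
theorem embed_lof (n : ℕ) (f : Cochain K V n) :
    embed K V (DirectSum.lof K ℕ (Cochain K V) n f) = double (onLists f) := by
  rw [embed, DirectSum.toModule_lof]; rfl

/-- At lists of length `n + 1`, `embed u` only depends on the component of `u` of degree `n`. -/
theorem embed_apply (u : ⨁ n, Cochain K V n) (n : ℕ) (w : List (V × V)) (hw : w.length = n + 1) :
    embed K V u w = double (onLists (u n)) w := by
  induction u using DirectSum.induction_on with
  | zero =>
    have : double (onLists (0 : Cochain K V n)) = 0 := map_zero (doubleHom K V n)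
    rw [map_zero, DirectSum.zero_apply, this]
  | of i f =>
    rw [← DirectSum.lof_eq_of K, embed_lof]
    by_cases h : i = n
    · subst h
      rw [DirectSum.lof_apply]
    · have e : DirectSum.lof K ℕ (Cochain K V) i f n = 0 := by
        rw [DirectSum.lof_eq_of]
        exact DirectSum.of_eq_of_ne _ _ _ (Ne.symm h)
      have : double (onLists (0 : Cochain K V n)) = 0 := map_zero (doubleHom K V n)
      rw [e, this, double_onLists_eq_zero f w (by omega)]
      rfl
  | add u v hu hv =>
    have : double (onLists (u n + v n)) = double (onLists (u n)) + double (onLists (v n)) :=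
      map_add (doubleHom K V n) _ _
    rw [map_add, Pi.add_apply, hu, hv, DirectSum.add_apply, this, Pi.add_apply]

theorem embed_injective : Function.Injective (embed K V) := by
  rw [← LinearMap.ker_eq_bot, LinearMap.ker_eq_bot']
  intro u hu
  refine DFinsupp.ext fun n => onLists_injective ?_
  funext L M
  have h0 : onLists (0 : Cochain K V n) = 0 := by
    have := onLists_smul (0 : K) (0 : Cochain K V n)
    rwa [zero_smul, zero_smul] at this
  rw [show (0 : ⨁ n, Cochain K V n) n = 0 from rfl, h0,
    ← snd_double_append (isBialternating_onLists (u n))]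
  by_cases hw :
      (L.map (fun x : V => (x, (0 : V))) ++ M.map fun y : V => ((0 : V), y)).length = n + 1
  · rw [← embed_apply u n _ hw, hu]; rfl
  · rw [double_onLists_eq_zero _ _ hw]; rfl

theorem neg_one_pow_smul {A : Type*} [AddCommGroup A] [Module K A] (k : ℕ) (a : A) :
    (-1 : K) ^ k • a = (-1 : ℤ) ^ k • a := by
  rcases Nat.even_or_odd k with h | h <;> simp [h.neg_one_pow]

/-- The embedding in the Nijenhuis–Richardson algebra is compatible with the compositions. -/
theorem double_circ (f : Cochain K V n) (g : Cochain K V m) :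
    double (onLists (circ K V n m f g)) = insertInto (double (onLists f)) (double (onLists g)) := by
  rw [onLists_circ, double_insert (isBialternating_onLists f)]

variable (K V)

/-- The Jacobi identity is an alternating sum of three pre-Lie identities for the
Nijenhuis–Richardson product on `V × V`. -/
theorem isGradedLieBracket_bracket : IsGradedLieBracket (bracket K V) where
  degree n m f g := by
    have cast : ∀ {a b : ℕ} (_ : a = b) (u : Cochain K V a), ∃ v : Cochain K V b,
        DirectSum.lof K ℕ (Cochain K V) a u = DirectSum.lof K ℕ (Cochain K V) b v := by
      rintro a _ rfl u
      exact ⟨u, rfl⟩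
    obtain ⟨v, hv⟩ := cast (add_comm m n) (circ K V m n g f)
    exact ⟨circ K V n m f g - (-1 : K) ^ (n * m) • v, by rw [bracket_lof, hv, map_sub, map_smul]⟩
  skew n m f g := by
    have : (-1 : K) ^ (n * m) * (-1) ^ (m * n) = 1 := by
      rw [mul_comm m n, ← mul_pow]; simp
    rw [bracket_lof, bracket_lof, smul_sub, smul_smul, this, one_smul, neg_sub]
  jacobi n m l f g h := by
    apply embed_injective
    have hf := (isBialternating_onLists f).double
    have hg := (isBialternating_onLists g).double
    have hh := (isBialternating_onLists h).double
    have pf := hasParity_double_onLists f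
    have pg := hasParity_double_onLists g
    have ph := hasParity_double_onLists h
    have h1 := associator_symm hf hg hh pg ph
    have h2 := associator_symm hg hf hh pf ph
    have h3 := associator_symm hh hf hg pf pg
    simp only [associator] at h1 h2 h3
    simp only [bracket_lof, map_sub, map_smul, map_add, LinearMap.sub_apply, LinearMap.smul_apply,
      embed_lof, double_circ]
    simp only [neg_one_pow_smul]
    have e1 : m * n = n * m := mul_comm _ _
    simp only [mul_add, add_mul, pow_add, e1]
    -- For each choice of the three signs, the identity is `-h1 + (-1)^{nm} h2 - (-1)^{nl+ml} h3`.
    rcases neg_one_pow_eq_or ℤ (n * m) with a | a <;>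
    rcases neg_one_pow_eq_or ℤ (n * l) with b | b <;>
    rcases neg_one_pow_eq_or ℤ (m * l) with c | c <;>
    simp only [a, b, c] at h1 h2 h3 ⊢ <;>
    first
    | linear_combination (norm := module) (-1 : ℤ) • h1 + h2 - h3
    | linear_combination (norm := module) (-1 : ℤ) • h1 + h2 + h3
    | linear_combination (norm := module) (-1 : ℤ) • h1 - h2 - h3
    | linear_combination (norm := module) (-1 : ℤ) • h1 - h2 + h3

end GradedLieAlgebra

/-! ### Maurer–Cartan elements -/

section MaurerCartan

section Equations

variable {K V : Type*} [CommRing K] [AddCommGroup V] [Module K V] (π : Cochain K V 1)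

theorem onLists_bracket (x y : V) : onLists π [] [x, y] = π 0 ![] ![x, y] := by
  have h := onLists_ofFn π (Nat.zero_le 1) rfl rfl ![] ![x, y]
  have e : List.ofFn ![x, y] = [x, y] := by simp
  rw [List.ofFn_zero, e] at h
  exact h

theorem onLists_prod (x y : V) : onLists π [x] [y] = π 1 ![x] ![y] := by
  have h := onLists_ofFn π (le_refl 1) rfl rfl ![x] ![y]
  have e : ∀ z : V, List.ofFn ![z] = [z] := fun z => by simp
  rw [e, e] at h
  exact h

/-- The composition `π ∘ π` vanishes if and only if the bracket `π₀` satisfies the Jacobi identity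
and the product `π₁` the two identities of a post-Lie algebra. -/
theorem circ_self_eq_zero_iff :
    circ K V 1 1 π π = 0 ↔
      (∀ x y z, π 0 ![] ![π 0 ![] ![x, y], z] - π 0 ![] ![π 0 ![] ![x, z], y] +
        π 0 ![] ![π 0 ![] ![y, z], x] = 0) ∧
      (∀ x y z, π 0 ![] ![π 1 ![x] ![y], z] - π 0 ![] ![π 1 ![x] ![z], y] -
        π 1 ![x] ![π 0 ![] ![y, z]] = 0) ∧
      (∀ x y z, π 1 ![π 0 ![] ![x, y]] ![z] + π 1 ![π 1 ![x] ![y]] ![z] -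
        π 1 ![π 1 ![y] ![x]] ![z] - π 1 ![x] ![π 1 ![y] ![z]] +
        π 1 ![y] ![π 1 ![x] ![z]] = 0) := by
  have z1 : onLists π [] [] = 0 := onLists_eq_zero π _ _ (by simp)
  have z2 : ∀ x, onLists π [] [x] = 0 := fun x => onLists_eq_zero π _ _ (by simp)
  have z3 : ∀ x y z l, onLists π [] (x :: y :: z :: l) = 0 :=
    fun x y z l => onLists_eq_zero π _ _ (by simp only [List.length_cons, List.length_nil]; omega)
  have z4 : ∀ x, onLists π [x] [] = 0 := fun x => onLists_eq_zero π _ _ (by simp)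
  have z5 : ∀ x y z l, onLists π [x] (y :: z :: l) = 0 :=
    fun x y z l => onLists_eq_zero π _ _ (by simp only [List.length_cons, List.length_nil]; omega)
  have z6 : ∀ x y l M, onLists π (x :: y :: l) M = 0 :=
    fun x y l M => onLists_eq_zero π _ _ (by simp only [List.length_cons]; omega)
  have b := isBialternating_onLists π
  have z7 : ∀ L M, onLists π L (0 :: M) = 0 := fun L M => (b.right L).map_zero_head M
  have key := onLists_circ π π
  simp only [← onLists_bracket, ← onLists_prod]
  have k0 : ∀ x y z, onLists (circ K V 1 1 π π) [] [x, y, z] =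
      onLists π [] [onLists π [] [x, y], z] - onLists π [] [onLists π [] [x, z], y] +
        onLists π [] [onLists π [] [y, z], x] := by
    intro x y z
    rw [key]
    simp [insertLeftArg, insertRightArg, insertInto, total, unshuffle_cons, z1, z2, z3, z5]
    abel
  have k1 : ∀ x y z, onLists (circ K V 1 1 π π) [x] [y, z] =
      onLists π [] [onLists π [x] [y], z] - onLists π [] [onLists π [x] [z], y] -
        onLists π [x] [onLists π [] [y, z]] := by
    intro x y z
    rw [key]
    simp [insertLeftArg, insertRightArg, insertInto, total, unshuffle_cons, z1, z2, z3, z4, z5,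
      z6]
    abel
  have k2 : ∀ x y z, onLists (circ K V 1 1 π π) [x, y] [z] =
      onLists π [onLists π [] [x, y]] [z] + onLists π [onLists π [x] [y]] [z] -
        onLists π [onLists π [y] [x]] [z] - onLists π [x] [onLists π [y] [z]] +
        onLists π [y] [onLists π [x] [z]] := by
    intro x y z
    rw [key]
    simp [insertLeftArg, insertRightArg, insertInto, total, unshuffle_cons, z4, z5, z6, z7]
    have h := (b.left [z]).map_add_head
    have h' : ∀ x, onLists π [-x] [z] = - onLists π [x] [z] := ((b.left [z]).head []).map_neg
    rw [h, h, h']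
    abel
  simp only [← k0, ← k1, ← k2]
  have h0 : onLists (0 : Cochain K V (1 + 1)) = 0 := by
    have := onLists_smul (0 : K) (0 : Cochain K V (1 + 1))
    rwa [zero_smul, zero_smul] at this
  constructor
  · intro h
    simp [h, h0]
  · rintro ⟨e0, e1, e2⟩
    apply onLists_injective
    rw [h0]
    funext L M
    match L, M with
    | [], [x, y, z] => exact e0 x y z
    | [x], [y, z] => exact e1 x y z
    | [x, y], [z] => exact e2 x y z
    | [], [] | [], [_] | [], [_, _] | [], (_ :: _ :: _ :: _ :: _) | [_], [] | [_], [_]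
    | [_], (_ :: _ :: _ :: _) | [_, _], [] | [_, _], (_ :: _ :: _) | (_ :: _ :: _ :: _), _ =>
      exact onLists_eq_zero _ _ _ (by simp only [List.length_cons, List.length_nil]; omega)

end Equations

section Correspondence

variable {K V : Type*} [CommRing K] [AddCommGroup V] [Module K V]

/-- The bilinear map `(x, y) ↦ π₀ (x y)`. -/
def Cochain.lie (π : Cochain K V 1) : V →ₗ[K] V →ₗ[K] V :=
  LinearMap.mk₂ K (fun x y => π 0 ![] ![x, y])
    (fun x x' y => (π 0 ![]).map_vecCons_add ![y] x x')
    (fun c x y => (π 0 ![]).map_vecCons_smul ![y] c x)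
    (fun x y y' => ((π 0 ![]).curryLeft x).map_vecCons_add ![] y y')
    (fun c x y => ((π 0 ![]).curryLeft x).map_vecCons_smul ![] c y)

/-- The bilinear map `(x, y) ↦ π₁ (x ⊗ y)`. -/
def Cochain.prod (π : Cochain K V 1) : V →ₗ[K] V →ₗ[K] V :=
  LinearMap.mk₂ K (fun x y => π 1 ![x] ![y])
    (fun x x' y => by
      have := (π 1).map_vecCons_add ![] x x'
      exact congrArg (fun φ => φ ![y]) this)
    (fun c x y => by
      have := (π 1).map_vecCons_smul ![] c x
      exact congrArg (fun φ => φ ![y]) this)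
    (fun x y y' => (π 1 ![x]).map_vecCons_add ![] y y')
    (fun c x y => (π 1 ![x]).map_vecCons_smul ![] c y)

theorem Cochain.lie_apply (π : Cochain K V 1) (x y : V) : π.lie x y = π 0 ![] ![x, y] := rfl

theorem Cochain.prod_apply (π : Cochain K V 1) (x y : V) : π.prod x y = π 1 ![x] ![y] := rfl

theorem Cochain.lie_self (π : Cochain K V 1) (x : V) : π.lie x x = 0 :=
  (π 0 ![]).map_eq_zero_of_eq ![x, x] (i := 0) (j := 1) rfl (by decide)

theorem Cochain.lie_swap (π : Cochain K V 1) (x y : V) : π.lie x y = - π.lie y x := by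
  have h : ∀ x, π.lie x x = 0 := π.lie_self
  exact (LinearMap.IsAlt.neg h y x).symm

theorem Cochain.ext_of_lie_prod {π π' : Cochain K V 1} (h : π.lie = π'.lie)
    (h' : π.prod = π'.prod) : π = π' := by
  have h0 : π 0 = π' 0 := by
    refine AlternatingMap.ext fun (v : Fin 0 → V) => AlternatingMap.ext fun (w : Fin 2 → V) => ?_
    have hv : v = ![] := Subsingleton.elim _ _
    have hw : w = ![w 0, w 1] := by
      funext a; fin_cases a <;> rfl
    rw [hv, hw]
    exact LinearMap.congr_fun (LinearMap.congr_fun h (w 0)) (w 1)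
  have h1 : π 1 = π' 1 := by
    refine AlternatingMap.ext fun (v : Fin 1 → V) => AlternatingMap.ext fun (w : Fin 1 → V) => ?_
    have hv : v = ![v 0] := by
      funext a; fin_cases a; rfl
    have hw : w = ![w 0] := by
      funext a; fin_cases a; rfl
    rw [hv, hw]
    exact LinearMap.congr_fun (LinearMap.congr_fun h' (v 0)) (w 0)
  funext i
  fin_cases i
  · exact h0
  · exact h1

/-- An alternating bilinear map as an alternating map in two arguments. -/
def altOfBilin (B : V →ₗ[K] V →ₗ[K] V) (hB : ∀ x, B x x = 0) : V [⋀^Fin 2]→ₗ[K] V where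
  toFun v := B (v 0) (v 1)
  map_update_add' v i x y := by
    fin_cases i <;> simp
  map_update_smul' v i c x := by
    fin_cases i <;> simp
  map_eq_zero_of_eq' v i j hv hij := by
    have h01 : v 0 = v 1 := by
      fin_cases i <;> fin_cases j <;> first | exact absurd rfl hij | exact hv | exact hv.symm
    rw [h01, hB]

/-- The cochain of degree `1` given by an alternating bilinear map and a bilinear map. -/
def cochainOfBilin (B P : V →ₗ[K] V →ₗ[K] V) (hB : ∀ x, B x x = 0) : Cochain K V 1
  | 0 => AlternatingMap.constOfIsEmpty K V (Fin 0) (altOfBilin B hB)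
  | 1 => AlternatingMap.ofSubsingleton K V (V [⋀^Fin 1]→ₗ[K] V) (0 : Fin 1)
      { toFun := fun x => AlternatingMap.ofSubsingleton K V V (0 : Fin 1) (P x)
        map_add' := fun x y => by ext; simp
        map_smul' := fun c x => by ext; simp }

end Correspondence

section CharZero

variable {K V : Type*} [Field K] [CharZero K] [AddCommGroup V] [Module K V]

/-- In degree `1` the bracket `[π, π]` is `2 (π ∘ π)`. -/
theorem isMaurerCartan_iff (π : Cochain K V 1) :
    IsMaurerCartan (bracket K V) π ↔ circ K V 1 1 π π = 0 := by
  rw [IsMaurerCartan, bracket_lof]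
  have e : DirectSum.lof K ℕ (Cochain K V) (1 + 1) (circ K V 1 1 π π) - (-1 : K) ^ (1 * 1) •
      DirectSum.lof K ℕ (Cochain K V) (1 + 1) (circ K V 1 1 π π) =
      (2 : K) • DirectSum.lof K ℕ (Cochain K V) (1 + 1) (circ K V 1 1 π π) := by
    module
  rw [e, smul_eq_zero_iff_right two_ne_zero]
  constructor
  · intro h
    have := congrArg (fun u => u (1 + 1)) h
    simpa [DirectSum.lof_apply] using this
  · intro h
    rw [h, map_zero]

theorem isMaurerCartan_iff_postLie (π : Cochain K V 1) :
    IsMaurerCartan (bracket K V) π ↔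
      (∀ x y z, π.lie x (π.lie y z) + π.lie y (π.lie z x) + π.lie z (π.lie x y) = 0) ∧
      (∀ x y z, π.prod x (π.lie y z) = π.lie (π.prod x y) z + π.lie y (π.prod x z)) ∧
      (∀ x y z, π.prod (π.lie x y + π.prod x y - π.prod y x) z =
        π.prod x (π.prod y z) - π.prod y (π.prod x z)) := by
  rw [isMaurerCartan_iff, circ_self_eq_zero_iff]
  simp only [← Cochain.lie_apply, ← Cochain.prod_apply]
  refine and_congr ?_ (and_congr ?_ ?_)
  · refine forall_congr' fun x => forall_congr' fun y => forall_congr' fun z => ?_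
    rw [π.lie_swap (π.lie x y) z, π.lie_swap (π.lie x z) y, π.lie_swap (π.lie y z) x,
      π.lie_swap x z, map_neg, ← neg_eq_zero]
    refine Eq.congr ?_ rfl
    abel
  · refine forall_congr' fun x => forall_congr' fun y => forall_congr' fun z => ?_
    rw [π.lie_swap (π.prod x z) y, sub_neg_eq_add, sub_eq_zero, eq_comm]
  · refine forall_congr' fun x => forall_congr' fun y => forall_congr' fun z => ?_
    rw [map_sub, map_add, LinearMap.sub_apply, LinearMap.add_apply, ← sub_eq_zero (b := _ - _)]
    refine Eq.congr ?_ rfl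
    abel

/-- The post-Lie algebra structure given by a Maurer–Cartan element. -/
def postLieOfMaurerCartan (π : {π : Cochain K V 1 // IsMaurerCartan (bracket K V) π}) :
    PostLieStructure K V where
  lie := π.1.lie
  lie_self := π.1.lie_self
  lie_jacobi := ((isMaurerCartan_iff_postLie π.1).1 π.2).1
  prod := π.1.prod
  prod_lie := ((isMaurerCartan_iff_postLie π.1).1 π.2).2.1
  lie_prod := ((isMaurerCartan_iff_postLie π.1).1 π.2).2.2

/-- Maurer–Cartan elements are the same as post-Lie algebra structures. -/
def maurerCartanEquiv :
    {π : Cochain K V 1 // IsMaurerCartan (bracket K V) π} ≃ PostLieStructure K V where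
  toFun := postLieOfMaurerCartan
  invFun S := ⟨cochainOfBilin S.lie S.prod S.lie_self,
    (isMaurerCartan_iff_postLie _).2 ⟨S.lie_jacobi, S.prod_lie, S.lie_prod⟩⟩
  left_inv _ := Subtype.ext (Cochain.ext_of_lie_prod rfl rfl)
  right_inv _ := rfl

end CharZero

end MaurerCartan

end PostLie

theorem mainTheorem1 (K V : Type*) [Field K] [CharZero K] [AddCommGroup V] [Module K V] :
    (∀ (n m : ℕ) (f : PostLie.Cochain K V n) (g : PostLie.Cochain K V m),
      PostLie.bracket K V (DirectSum.lof K ℕ (PostLie.Cochain K V) n f)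
          (DirectSum.lof K ℕ (PostLie.Cochain K V) m g) =
        DirectSum.lof K ℕ (PostLie.Cochain K V) (n + m) (PostLie.circ K V n m f g) -
          (-1 : K) ^ (n * m) •
            DirectSum.lof K ℕ (PostLie.Cochain K V) (m + n) (PostLie.circ K V m n g f)) ∧
    PostLie.IsGradedLieBracket (PostLie.bracket K V) ∧
    ∃ e : {π : PostLie.Cochain K V 1 // PostLie.IsMaurerCartan (PostLie.bracket K V) π} ≃
        PostLie.PostLieStructure K V,
      ∀ π x y, (e π).lie x y = π.1 0 ![] ![x, y] ∧ (e π).prod x y = π.1 1 ![x] ![y] :=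
  ⟨PostLie.bracket_lof, PostLie.isGradedLieBracket_bracket K V, PostLie.maurerCartanEquiv,
    fun _ _ _ => ⟨rfl, rfl⟩⟩
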